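/- Let $\mathbb D=\mathbb R$ or $\mathbb D=\mathbb T=\mathbb R/2\pi\mathbb Z$. Let $V\in C^\infty(\mathbb D)$ with $Z=\int_{\mathbb D}e^{-V}<\infty$, let $\mu=e^{-V}/Z$, and let $f\in C^\infty(\mathbb D)$ be $\mu$-integrable and not $\mu$-almost everywhere constant. Put $I=\int_{\mathbb D} f\,d\mu$. For $U:\mathbb D\to\mathbb R$ write $Z[U]=\int_{\mathbb D}e^{-V-U}$ and $\mu_U=e^{-V-U}/Z[U]$. Let $\mathfrak U_0$ be the set of biasing potentials $U\in C^\infty(\mathbb D)$ such that: (i) $e^{-V-U}$ is Lebesgue integrable on $\mathbb D$; (ii) $\mu_U$ satisfies a Poincaré inequality: there is $R>0$ with $\|\varphi\|_{L^2(\mu_U)}^2\le \frac1R\|\varphi'\|_{L^2(\mu_U)}^2$ for all $\varphi\in H^1(\mu_U)\cap L^2_0(\mu_U)$, where $L^2_0(\mu_U)$ is the space of $\mu_U$-mean-zero functions of $L^2(\mu_U)$ and $H^1(\mu_U)$ is the space of functions of $L^2(\mu_U)$ with weak derivative in $L^2(\mu_U)$; (iii) $(f-I)e^U\in L^2(\mu_U)$;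 (iv) for every $x_0\in\mathbb D$ there is a unique strong solution of $dX_t=-(V+U)'(X_t)\,dt+\sqrt2\,dW_t$ with $X_0=x_0$. The asymptotic variance associated with $U$ is $$\sigma^2_f[U]=\frac{2Z[U]^2}{Z^2}\int_{\mathbb D}|\phi_U'|^2\,d\mu_U,$$ where $\phi_U\in H^1(\mu_U)\cap L^2_0(\mu_U)$ is the distributional solution of $-\mathcal L_U\phi_U=(f-I)e^U$, with $\mathcal L_U=-(V+U)'\,\partial_x+\partial_x^2$. Let $F(x)=\int_0^x(f-I)e^{-V}$, let $A^*_{\mathbb R}=-\int_{-\infty}^0(f-I)e^{-V}$ and $A^*_{\mathbb T}=\sup\{A\in\mathbb R:\int_{\mathbb T}\operatorname{sgn}(F-A)\ge0\}$ (a median of $F$), and set $$\sigma^*_f=\frac{2}{Z^2}\left(\int_{\mathbb D}|F-A^*_{\mathbb D}|\,dx\right)^2 .$$ Suppose that $0\in\mathfrak U_0$. Then $C_c^\infty(\mathbb D)\subset\mathfrak U_0$; for every $U\in\mathfrak U_0$ the solution $\phi_U$ exists and is unique (up to null sets), so that $\sigma^2_f[U]$ is well defined; $F-A^*_{\mathbb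 D}$ is integrable on $\mathbb D$; and $$\inf_{U\in\mathfrak U_0}\sigma^2_f[U]=\sigma^*_f,\qquad \inf_{U\in C_c^\infty(\mathbb D)}\sigma^2_f[U]=\sigma^*_f .$$ -/

import Mathlib

open MeasureTheory ProbabilityTheory
open scoped ContDiff NNReal

namespace BiasedLangevin

noncomputable section

/-- The two one-dimensional state spaces `𝔻`: the real line, and the torus `𝕋 = ℝ / 2πℤ`.
A function on the torus is represented by a `2π`-periodic function on `ℝ`, or, when only its class
modulo null sets matters, by its values on the fundamental domain `(-π, π]`. -/
inductive Dom
  | line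
  | torus

/-- Lebesgue measure on `𝔻` (for the torus: carried by the fundamental domain `(-π, π]`). -/
def Dom.vol : Dom → Measure ℝ
  | .line => volume
  | .torus => volume.restrict (Set.Ioc (-Real.pi) Real.pi)

/-- `u ∈ C^∞(𝔻)`. -/
def Dom.Smooth : Dom → (ℝ → ℝ) → Prop
  | .line, u => ContDiff ℝ ∞ u
  | .torus, u => ContDiff ℝ ∞ u ∧ Function.Periodic u (2 * Real.pi)

/-- `u ∈ C_c^∞(𝔻)`; the torus being compact, `C_c^∞(𝕋) = C^∞(𝕋)`. -/
def Dom.SmoothCompact : Dom → (ℝ → ℝ) → Prop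
  | .line, u => ContDiff ℝ ∞ u ∧ HasCompactSupport u
  | .torus, u => ContDiff ℝ ∞ u ∧ Function.Periodic u (2 * Real.pi)

/-- The normalization constant `∫_𝔻 e^{-W}` of a potential `W`. It is `Z` for `W = V`, and `Z[U]`
for `W = V + U`. -/
def partition (D : Dom) (W : ℝ → ℝ) : ℝ := ∫ x, Real.exp (-W x) ∂D.vol

/-- The probability measure on `𝔻` with density `e^{-W} / ∫_𝔻 e^{-W}`. It is `μ` for `W = V`, and
`μ_U` for `W = V + U`. -/
def gibbs (D : Dom) (W : ℝ → ℝ) : Measure ℝ :=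
  D.vol.withDensity fun x => ENNReal.ofReal (Real.exp (-W x) / partition D W)

/-- `I = ∫ f dμ`. -/
def mean (D : Dom) (V f : ℝ → ℝ) : ℝ := ∫ x, f x ∂(gibbs D V)

/-! ### Sobolev space, Poincaré inequality -/

/-- `φ'` is the weak (distributional) derivative of `φ` on `𝔻`. -/
def IsWeakDeriv (D : Dom) (φ φ' : ℝ → ℝ) : Prop :=
  ∀ η : ℝ → ℝ, D.SmoothCompact η → ∫ x, φ x * deriv η x ∂D.vol = -∫ x, φ' x * η x ∂D.vol

/-- `φ ∈ H¹(ν) ∩ L²₀(ν)`, with weak derivative `φ'`. -/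
structure MemH1Zero (D : Dom) (ν : Measure ℝ) (φ φ' : ℝ → ℝ) : Prop where
  memLp : MemLp φ 2 ν
  mean_zero : ∫ x, φ x ∂ν = 0
  memLp_deriv : MemLp φ' 2 ν
  weakDeriv : IsWeakDeriv D φ φ'

/-- `ν` satisfies a Poincaré inequality. -/
def Poincare (D : Dom) (ν : Measure ℝ) : Prop :=
  ∃ R : ℝ, 0 < R ∧ ∀ φ φ' : ℝ → ℝ, MemH1Zero D ν φ φ' →
    ∫ x, φ x ^ 2 ∂ν ≤ 1 / R * ∫ x, φ' x ^ 2 ∂ν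

/-! ### Strong solutions of the stochastic differential equation -/

/-- `X` is a strong solution of `dX_t = b(X_t) dt + √2 dB_t`, `X_0 = x₀`, on the given probability
space and for the given Brownian motion `B`. Adaptedness is to the filtration generated by `B` and
completed by the null sets. -/
structure IsStrongSolution {Ω : Type} [MeasurableSpace Ω] (P : Measure Ω) (B : ℝ≥0 → Ω → ℝ)
    (b : ℝ → ℝ) (x₀ : ℝ) (X : ℝ≥0 → Ω → ℝ) : Prop where
  adapted : ∀ t : ℝ≥0,
    AEStronglyMeasurable[⨆ s ≤ t, MeasurableSpace.comap (B s) inferInstance] (X t) P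
  continuous : ∀ᵐ w ∂P, Continuous fun t => X t w
  equation : ∀ᵐ w ∂P, ∀ t : ℝ≥0,
    X t w = x₀ + (∫ s in (0 : ℝ)..t, b (X s.toNNReal w)) + √2 * B t w

/-- From every deterministic initial condition, on every probability space with a Brownian motion,
the equation `dX_t = b(X_t) dt + √2 dB_t` has a strong solution, unique up to
indistinguishability. When `b` is periodic this is the well-posedness of the equation on the
torus, written for the continuous lift of the solution to `ℝ`. -/
def StronglyWellPosed (b : ℝ → ℝ) : Prop :=
  ∀ (x₀ : ℝ) (Ω : Type) [MeasurableSpace Ω] (P : Measure Ω) [IsProbabilityMeasure P]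
    (B : ℝ≥0 → Ω → ℝ), (∀ t, Measurable (B t)) → IsBrownianReal B P →
    ∃ X : ℝ≥0 → Ω → ℝ, IsStrongSolution P B b x₀ X ∧
      ∀ Y : ℝ≥0 → Ω → ℝ, IsStrongSolution P B b x₀ Y → ∀ᵐ w ∂P, ∀ t, Y t w = X t w

/-! ### Biasing potentials and asymptotic variance -/

/-- The set `𝔘₀(V, f)` of nice biasing potentials. -/
structure MemU0 (D : Dom) (V f U : ℝ → ℝ) : Prop where
  smooth : D.Smooth U
  integrable : Integrable (fun x => Real.exp (-(V + U) x)) D.vol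
  poincare : Poincare D (gibbs D (V + U))
  memLp : MemLp (fun x => (f x - mean D V f) * Real.exp (U x)) 2 (gibbs D (V + U))
  wellPosed : StronglyWellPosed fun x => -deriv (V + U) x

/-- The generator `𝓛 η = -W' η' + η''` of the overdamped Langevin dynamics with potential `W`. -/
def generator (W η : ℝ → ℝ) (x : ℝ) : ℝ := -deriv W x * deriv η x + deriv (deriv η) x

/-- `φ ∈ H¹(μ_U) ∩ L²₀(μ_U)`, with weak derivative `φ'`, is a distributional solution of the Poisson
equation `-𝓛_U φ = (f - I) e^U`. The generator `𝓛_U`, which is symmetric with respect to `μ_U`, is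
moved to the test functions. -/
structure IsPoissonSolution (D : Dom) (V f U φ φ' : ℝ → ℝ) : Prop where
  memH1Zero : MemH1Zero D (gibbs D (V + U)) φ φ'
  equation : ∀ η : ℝ → ℝ, D.SmoothCompact η →
    ∫ x, φ x * -generator (V + U) η x ∂(gibbs D (V + U)) =
      ∫ x, (f x - mean D V f) * Real.exp (U x) * η x ∂(gibbs D (V + U))

open Classical in
/-- The asymptotic variance `σ²_f[U] = (2 Z[U]² / Z²) ∫ |φ_U'|² dμ_U`, where `φ_U` is the solution of
the Poisson equation (value `0` if there is no solution). -/
def asymVar (D : Dom) (V f U : ℝ → ℝ) : ℝ :=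
  if h : ∃ p : (ℝ → ℝ) × (ℝ → ℝ), IsPoissonSolution D V f U p.1 p.2 then
    2 * partition D (V + U) ^ 2 / partition D V ^ 2 *
      ∫ x, |h.choose.2 x| ^ 2 ∂(gibbs D (V + U))
  else 0

/-! ### The optimal value -/

/-- `F(x) = ∫₀ˣ (f - I) e^{-V}`. -/
def primF (D : Dom) (V f : ℝ → ℝ) (x : ℝ) : ℝ :=
  ∫ ξ in (0 : ℝ)..x, (f ξ - mean D V f) * Real.exp (-V ξ)

/-- The constant `A*_𝔻`: `-∫_{-∞}^0 (f - I) e^{-V}` on the line, and the median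
`sup {A | ∫_𝕋 sgn(F - A) ≥ 0}` of `F` on the torus. -/
def Astar (D : Dom) (V f : ℝ → ℝ) : ℝ :=
  match D with
  | .line => -∫ x in Set.Iic (0 : ℝ), (f x - mean .line V f) * Real.exp (-V x)
  | .torus => sSup {A : ℝ | 0 ≤ ∫ x, Real.sign (primF .torus V f x - A) ∂Dom.torus.vol}

/-- `σ*_f = (2 / Z²) (∫_𝔻 |F - A*_𝔻|)²`. -/
def sigmaStar (D : Dom) (V f : ℝ → ℝ) : ℝ :=
  2 / partition D V ^ 2 * (∫ x, |primF D V f x - Astar D V f| ∂D.vol) ^ 2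

end

end BiasedLangevin

/-! In one dimension the Poisson equation integrates explicitly. Writing it as `(e^{-(V+U)} φ')' =
-(f - I) e^{-V}` gives `φ_U' = -(F - A_U) e^{V+U}`. On the line square integrability forces `A_U =
A*`; on the torus periodicity of `φ_U` forces `A_U` to be the mean of `F` with weight `e^{V+U}`.
Hence (`asymVar_eq`) `σ²_f[U] = (2/Z²) Z[U] ∫ (F - A_U)² e^{V+U}`.

Lower bound (`sigmaStar_le_asymVar`): by Cauchy–Schwarz the product is at least `(∫ |F - A_U|)²`,
and the median minimises `A ↦ ∫ |F - A|`. Equality would need `e^{-V-U}` proportional to `|F - A*|`,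
which may vanish or fail to be smooth. `exists_biasing_le` regularises this density, glues it to
`e^{-V}` far out with a cutoff, and lets the errors tend to `0`. On the torus `A_U` minimises the
weighted quadratic integral, so replacing it by `A*` only enlarges the upper bound.

The rest justifies these computations. The Poincaré inequality yields `F - A* ∈ L²(e^{V+U})` by
duality (`Poincare.integrable_flux_sq`) and `φ_U ∈ L²(μ_U)` by truncation
(`Poincare.integrable_sq`). For uniqueness, two derivatives differ by `c e^{V+U}`, which is excluded
unless `c = 0` (`poisson_deriv_unique`).

That test functions are nice biasing potentials rests on Holley–Stroock and on stability of strong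
well-posedness (`StronglyWellPosed.of_eq_off_compact`). The noise is additive, so the equation is
solved path by path. A solution with modified drift is trapped between solutions of the original
equation restarted at a countable family of times and levels, so it cannot explode. -/

namespace BiasedLangevin

open Set Filter Topology

/-! ### Integral equations driven by a continuous path -/

/-- On `[s, t]`, the continuous function `x` solves `dx = b(x) du + dp`. -/
structure IsDriven (b p x : ℝ → ℝ) (s t : ℝ) : Prop where
  cont : Continuous x
  eq : ∀ r ∈ Icc s t, x r = x s + (∫ u in s..r, b (x u)) + (p r - p s)

namespace IsDriven

variable {b g p x y : ℝ → ℝ} {s t s' t' : ℝ}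

lemma sub_eq (hb : Continuous b) (hx : IsDriven b p x s t) {r r' : ℝ} (hr : r ∈ Icc s t)
    (hr' : r' ∈ Icc s t) : x r' - x r = (∫ u in r..r', b (x u)) + (p r' - p r) := by
  have hc : Continuous fun u => b (x u) := hb.comp hx.cont
  have h := intervalIntegral.integral_interval_sub_left (hc.intervalIntegrable (μ := volume) s r')
    (hc.intervalIntegrable s r)
  rw [hx.eq r hr, hx.eq r' hr', ← h]
  ring

lemma mono (hb : Continuous b) (hx : IsDriven b p x s t) (hs : s ≤ s') (ht : t' ≤ t) :
    IsDriven b p x s' t' where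
  cont := hx.cont
  eq r hr := by
    have := hx.sub_eq hb (r := s') (r' := r) ⟨hs, hr.1.trans (hr.2.trans ht)⟩
      ⟨hs.trans hr.1, hr.2.trans ht⟩
    linarith

lemma congr_drift (hx : IsDriven b p x s t) (h : ∀ u ∈ Icc s t, b (x u) = g (x u)) :
    IsDriven g p x s t where
  cont := hx.cont
  eq r hr := by
    rw [hx.eq r hr]
    congr 2
    refine intervalIntegral.integral_congr fun u hu => ?_
    rw [uIcc_of_le hr.1] at hu
    exact h u ⟨hu.1, hu.2.trans hr.2⟩

lemma neg (hx : IsDriven b p x s t) :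
    IsDriven (fun z => -b (-z)) (fun u => -p u) (fun u => -x u) s t where
  cont := hx.cont.neg
  eq r hr := by
    rw [hx.eq r hr]
    simp only [neg_neg, intervalIntegral.integral_neg]
    ring

/-- The driving path cancels in `x - y`, which is therefore `C¹` although `x` and `y` need not be.
Both paths stay in a compact interval where `b` is Lipschitz, and Grönwall applies. -/
lemma eq_of_eq_left (hb : LocallyLipschitz b) (hx : IsDriven b p x s t) (hy : IsDriven b p y s t)
    (h : x s = y s) : ∀ r ∈ Icc s t, x r = y r := by
  have hbc := hb.continuous
  obtain ⟨M, hM⟩ := (isCompact_Icc (a := s) (b := t)).exists_bound_of_continuousOn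
    hx.cont.continuousOn
  obtain ⟨N, hN⟩ := (isCompact_Icc (a := s) (b := t)).exists_bound_of_continuousOn
    hy.cont.continuousOn
  obtain ⟨K, hK⟩ := (hb.locallyLipschitzOn (s := Icc (-max M N) (max M N))).exists_lipschitzOnWith_of_compact
    isCompact_Icc
  have hcx : Continuous fun u => b (x u) := hbc.comp hx.cont
  have hcy : Continuous fun u => b (y u) := hbc.comp hy.cont
  have key : ∀ r ∈ Icc s t, x r - y r = ∫ u in s..r, (b (x u) - b (y u)) := fun r hr => by
    rw [intervalIntegral.integral_sub (hcx.intervalIntegrable _ _) (hcy.intervalIntegrable _ _),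
      hx.eq r hr, hy.eq r hr, h]
    ring
  have hd : ∀ r, HasDerivAt (fun r => ∫ u in s..r, (b (x u) - b (y u))) (b (x r) - b (y r)) r :=
    fun r => (hcx.sub hcy).integral_hasStrictDerivAt s r |>.hasDerivAt
  have h0 := eq_zero_of_abs_deriv_le_mul_abs_self_of_eq_zero_right (K := K) (a := s) (b := t)
    (fun r _ => (hd r).continuousAt.continuousWithinAt) (fun r _ => (hd r).hasDerivWithinAt)
    (by simp) (fun r hr => by
      have hr' : r ∈ Icc s t := ⟨hr.1, hr.2.le⟩
      rw [← key r hr', ← dist_eq_norm, ← dist_eq_norm]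
      have h1 := hM r hr'
      have h2 := hN r hr'
      rw [Real.norm_eq_abs] at h1 h2
      exact hK.dist_le_mul _ (abs_le.1 (h1.trans (le_max_left _ _))) _
        (abs_le.1 (h2.trans (le_max_right _ _))))
  intro r hr
  have := h0 r hr
  rw [← key r hr] at this
  linarith

/-- Scalar solutions cannot cross: they would meet at some earlier time and coincide from then on.
-/
lemma le_of_le_left (hb : LocallyLipschitz b) (hx : IsDriven b p x s t) (hy : IsDriven b p y s t)
    (h : x s ≤ y s) : ∀ r ∈ Icc s t, x r ≤ y r := by
  intro r hr
  by_contra! hlt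
  have hc : ContinuousOn (fun u => x u - y u) (Icc s r) := (hx.cont.sub hy.cont).continuousOn
  obtain ⟨q, hq, hq0⟩ := intermediate_value_Icc hr.1 hc (show (0 : ℝ) ∈ Icc _ _ from
    ⟨by linarith, by linarith⟩)
  have := eq_of_eq_left hb (hx.mono hb.continuous hq.1 hr.2) (hy.mono hb.continuous hq.1 hr.2)
    (by simpa [sub_eq_zero] using hq0) r ⟨hq.2, le_rfl⟩
  linarith

end IsDriven

/-- Subtracting the noise turns the equation into the ODE `y' = b(y + p)`. Since `|b| ≤ C`, its
solution stays within `C T` of its start, so Picard–Lindelöf covers all of `[0, T]` at once. -/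
lemma exists_isDriven_of_bounded {b p : ℝ → ℝ} {K : ℝ≥0} {C : ℝ} (hb : LipschitzWith K b)
    (hC : ∀ z, |b z| ≤ C) (hp : Continuous p) (x₀ : ℝ) {T : ℝ} (hT : 0 ≤ T) :
    ∃ x, IsDriven b p x 0 T ∧ x 0 = x₀ := by
  have hC0 : 0 ≤ C := (abs_nonneg _).trans (hC 0)
  lift C to ℝ≥0 using hC0
  lift T to ℝ≥0 using hT
  have hP : IsPicardLindelof (fun u z => b (z + p u)) (tmin := 0) (tmax := (T : ℝ))
      ⟨0, by simp⟩ (x₀ - p 0) (C * T) 0 C K := by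
    refine ⟨fun u _ => ?_, fun z _ => ?_, fun u _ z _ => hC _, by simp⟩
    · refine (LipschitzWith.of_dist_le_mul fun z z' => ?_).lipschitzOnWith
      simpa using hb.dist_le_mul (z + p u) (z' + p u)
    · exact (hb.continuous.comp (by fun_prop)).continuousOn
  obtain ⟨α, hα0, hα⟩ := hP.exists_eq_forall_mem_Icc_hasDerivWithinAt₀
  have hαc : ContinuousOn α (Icc 0 T) := fun u hu => (hα u hu).continuousWithinAt
  set β : ℝ → ℝ := IccExtend T.2 ((Icc (0 : ℝ) T).domRestrict α)
  have hβc : Continuous β := (continuousOn_iff_continuous_domRestrict.1 hαc).Icc_extend'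
  have hβ : ∀ u ∈ Icc (0 : ℝ) T, β u = α u := fun u hu => IccExtend_of_mem _ _ hu
  have hβ0 : β 0 = x₀ - p 0 := by rw [hβ 0 ⟨le_rfl, T.2⟩]; exact hα0
  refine ⟨fun u => β u + p u, ⟨by fun_prop, fun r hr => ?_⟩, by simp [hβ0]⟩
  have hc : Continuous fun u => b (β u + p u) := hb.continuous.comp (by fun_prop)
  have h := intervalIntegral.integral_eq_sub_of_hasDerivAt_of_le (f := β)
    (f' := fun u => b (β u + p u)) hr.1 hβc.continuousOn (fun u hu => by
      have hu' : u ∈ Ioo (0 : ℝ) T := ⟨hu.1, hu.2.trans_le hr.2⟩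
      have hn : Icc (0 : ℝ) T ∈ 𝓝 u := Icc_mem_nhds hu'.1 hu'.2
      rw [hβ u (Ioo_subset_Icc_self hu')]
      exact ((hα u (Ioo_subset_Icc_self hu')).hasDerivAt hn).congr_of_eventuallyEq
        (eventually_of_mem hn hβ)) (hc.intervalIntegrable _ _)
  rw [h]
  ring

/-- Existence on `[0, T]` follows from an a priori bound. -/
lemma exists_isDriven_of_apriori {b p : ℝ → ℝ} (hb : LocallyLipschitz b) (hp : Continuous p)
    (x₀ : ℝ) {T C : ℝ} (hT : 0 ≤ T)
    (hC : ∀ t ∈ Icc 0 T, ∀ x, IsDriven b p x 0 t → x 0 = x₀ → |x t| ≤ C) :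
    ∃ x, IsDriven b p x 0 T ∧ x 0 = x₀ := by
  have hx₀ : |x₀| ≤ C := by
    have := hC 0 ⟨le_rfl, hT⟩ (fun _ => x₀) ⟨continuous_const, fun r hr => by
      rw [le_antisymm hr.2 hr.1]; simp⟩ rfl
    simpa using this
  have hC0 : 0 ≤ C := (abs_nonneg _).trans hx₀
  have hM : -(C + 1) ≤ C + 1 := by linarith
  obtain ⟨K, hK⟩ := (hb.locallyLipschitzOn (s := Icc (-(C + 1)) (C + 1))).exists_lipschitzOnWith_of_compact
    isCompact_Icc
  obtain ⟨L, hL⟩ := (isCompact_Icc (a := -(C + 1)) (b := C + 1)).exists_bound_of_continuousOn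
    hb.continuous.continuousOn
  -- Truncating the argument makes the drift bounded and globally Lipschitz without changing it on
  -- `[-(C + 1), C + 1]`.
  set g : ℝ → ℝ := fun z => b (projIcc (-(C + 1)) (C + 1) hM z)
  have hgK : LipschitzWith (K * 1) g :=
    (lipschitzOnWith_iff_restrict.1 hK).comp (LipschitzWith.projIcc hM)
  obtain ⟨x, hx, hx0⟩ := exists_isDriven_of_bounded hgK (C := L) (fun z => hL _ (projIcc _ _ hM z).2)
    hp x₀ hT
  have hgb : ∀ z, |z| ≤ C + 1 → g z = b z := fun z hz => by
    simp only [g, projIcc_of_mem hM (abs_le.1 hz)]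
  -- Up to the first time `u` with `|x u| ≥ C + 1`, the path solves the original equation, so the a
  -- priori bound gives `|x u| ≤ C`, a contradiction.
  have hbd : ∀ u ∈ Icc 0 T, |x u| < C + 1 := by
    by_contra! hne
    have hcl : IsCompact ({u | C + 1 ≤ |x u|} ∩ Icc 0 T) :=
      isCompact_Icc.inter_left (isClosed_le continuous_const hx.cont.abs)
    obtain ⟨u, hu, hul⟩ := hcl.exists_isLeast (by
      obtain ⟨u, hu, hu'⟩ := hne; exact ⟨u, hu', hu⟩)
    have hlt : ∀ v ∈ Ico 0 u, |x v| < C + 1 := fun v hv => by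
      by_contra! hv'
      exact absurd (hul ⟨hv', hv.1, hv.2.le.trans hu.2.2⟩) (not_le.2 hv.2)
    have hle : ∀ v ∈ Icc 0 u, |x v| ≤ C + 1 := by
      have hu0 : (0 : ℝ) ≠ u := by
        rintro rfl
        have := hu.1
        simp only [mem_ofPred_eq, hx0] at this
        linarith
      intro v hv
      have : v ∈ closure (Ico 0 u) := by rwa [closure_Ico hu0]
      exact closure_minimal (fun w hw => (hlt w hw).le)
        (isClosed_le hx.cont.abs continuous_const) this
    have h1 := hC u hu.2 x ((hx.mono hgK.continuous le_rfl hu.2.2).congr_drift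
      fun v hv => hgb _ (hle v hv)) hx0
    have := hu.1
    simp only [mem_ofPred_eq] at this
    linarith
  exact ⟨x, hx.congr_drift fun v hv => hgb _ (hbd v hv).le, hx0⟩

/-- A global solution exists if there are a priori bounds on all finite time intervals. -/
lemma exists_isDriven_forall {b p : ℝ → ℝ} (hb : LocallyLipschitz b) (hp : Continuous p)
    (x₀ : ℝ) (hC : ∀ T : ℝ, 0 ≤ T → ∃ C,
      ∀ t ∈ Icc 0 T, ∀ x, IsDriven b p x 0 t → x 0 = x₀ → |x t| ≤ C) :
    ∃ x, (∀ T, IsDriven b p x 0 T) ∧ x 0 = x₀ := by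
  have h : ∀ n : ℕ, ∃ x, IsDriven b p x 0 n ∧ x 0 = x₀ := fun n => by
    obtain ⟨C, hC'⟩ := hC n n.cast_nonneg
    exact exists_isDriven_of_apriori hb hp x₀ n.cast_nonneg hC'
  choose y hy hy0 using h
  have hyy : ∀ m n : ℕ, ∀ u ∈ Icc (0 : ℝ) (min m n), y m u = y n u := fun m n u hu =>
    IsDriven.eq_of_eq_left hb ((hy m).mono hb.continuous le_rfl (min_le_left _ _))
      ((hy n).mono hb.continuous le_rfl (min_le_right _ _)) (by rw [hy0, hy0]) u hu
  -- Uniqueness makes the solutions on `[0, n]` compatible; the glued path is constant for negative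
  -- times.
  set x : ℝ → ℝ := fun u => y ⌈u⌉₊ (max u 0)
  have hxy : ∀ n : ℕ, ∀ u ≤ (n : ℝ), x u = y n (max u 0) := fun n u hu =>
    hyy _ _ _ ⟨le_max_right _ _, le_min (max_le (Nat.le_ceil u) (Nat.cast_nonneg _))
      (max_le hu n.cast_nonneg)⟩
  have hxc : Continuous x := by
    refine continuous_iff_continuousAt.2 fun u => ?_
    obtain ⟨n, hn⟩ := exists_nat_gt u
    refine ContinuousAt.congr ?_ (eventually_of_mem (Iic_mem_nhds hn) fun v hv => (hxy n v hv).symm)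
    exact ((hy n).cont.comp (by fun_prop : Continuous fun u : ℝ => max u 0)).continuousAt
  have hx0 : x 0 = x₀ := by simp [x, hy0]
  refine ⟨x, fun T => ⟨hxc, fun r hr => ?_⟩, hx0⟩
  obtain ⟨n, hn⟩ := exists_nat_ge r
  have hxr : ∀ u ∈ Icc (0 : ℝ) r, x u = y n u := fun u hu => by
    rw [hxy n u (hu.2.trans hn), max_eq_left hu.1]
  rw [hxr r ⟨hr.1, le_rfl⟩, (hy n).eq r ⟨hr.1, hn⟩, hx0, hy0]
  congr 2
  refine intervalIntegral.integral_congr fun u hu => ?_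
  rw [uIcc_of_le hr.1] at hu
  simp only [hxr u hu]

/-! ### The Euler scheme -/

/-- The explicit Euler scheme of step `h` for `dx = b(x) du + dp`. -/
noncomputable def euler (b p : ℝ → ℝ) (x₀ h : ℝ) : ℕ → ℝ
  | 0 => x₀
  | k + 1 => euler b p x₀ h k + h * b (euler b p x₀ h k) + (p ((k + 1) * h) - p (k * h))

/-- This serves adaptedness: it writes `x t` as a limit of functions of finitely many values of `p`
on `[0, t]`. The proof is a discrete Grönwall estimate, in which the error is also kept below `1` so
that one local Lipschitz constant suffices. -/
lemma tendsto_euler {b p x : ℝ → ℝ} (hb : LocallyLipschitz b) {t : ℝ} (ht : 0 ≤ t)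
    (hx : IsDriven b p x 0 t) :
    Tendsto (fun N : ℕ => euler b p (x 0) (t / N) N) atTop (𝓝 (x t)) := by
  obtain ⟨M, hM⟩ := (isCompact_Icc (a := 0) (b := t)).exists_bound_of_continuousOn
    hx.cont.continuousOn
  obtain ⟨K, hK⟩ := (hb.locallyLipschitzOn (s := Icc (-(M + 1)) (M + 1))).exists_lipschitzOnWith_of_compact
    isCompact_Icc
  rw [Metric.tendsto_atTop]
  intro ε₀ hε₀
  set ε := min (ε₀ / 2) 1
  have hε : 0 < ε := lt_min (by linarith) one_pos
  -- With this choice the Grönwall bound `t K η e^{Kt}` is at most `ε`, hence at most both `ε₀ / 2`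
  -- and `1`; the `+ 1` avoids a zero denominator.
  set η := ε / ((t * K + 1) * Real.exp (K * t))
  have hη : 0 < η := by positivity
  obtain ⟨δ, hδ, hδ'⟩ := Metric.uniformContinuousOn_iff.1
    (isCompact_Icc.uniformContinuousOn_of_continuous (hx.cont.continuousOn (s := Icc 0 t))) η hη
  obtain ⟨N₀, hN₀⟩ := exists_nat_gt (t / δ)
  refine ⟨N₀ + 1, fun N hN => ?_⟩
  have hNN : (N₀ : ℝ) + 1 ≤ N := by exact_mod_cast hN
  have hN0 : (0 : ℝ) < N := by linarith [N₀.cast_nonneg (α := ℝ)]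
  set h := t / N
  have hh : 0 ≤ h := by positivity
  have hhδ : h < δ := by
    rw [div_lt_iff₀ hN0]
    rw [div_lt_iff₀ hδ] at hN₀
    nlinarith
  have hNh : N * h = t := by simp only [h]; field_simp
  have main : ∀ k : ℕ, k ≤ N → |euler b p (x 0) h k - x (k * h)| ≤
      k * h * K * η * Real.exp (K * (k * h)) := by
    intro k
    induction k with
    | zero => intro _; simp [euler]
    | succ k ih =>
      intro hk
      have ih := ih (by omega)
      have hkN : ((k : ℝ) + 1) ≤ N := by exact_mod_cast hk
      have hk1 : ((k : ℝ) + 1) * h ≤ t := by rw [← hNh]; gcongr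
      have hk0 : (k : ℝ) * h ≤ (k + 1) * h := by gcongr; linarith
      have hkm : (k : ℝ) * h ∈ Icc 0 t := ⟨by positivity, hk0.trans hk1⟩
      have hkm1 : ((k : ℝ) + 1) * h ∈ Icc 0 t := ⟨by positivity, hk1⟩
      set E := euler b p (x 0) h k
      set X := x (k * h)
      have hEX : |E - X| ≤ 1 := by
        calc |E - X| ≤ k * h * K * η * Real.exp (K * (k * h)) := ih
          _ ≤ t * K * η * Real.exp (K * t) := by
            have := hkm.2
            gcongr
          _ = (t * K) / (t * K + 1) * ε := by simp only [η]; field_simp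
          _ ≤ 1 * 1 := by
            gcongr
            · rw [div_le_one (by positivity)]; linarith
            · exact min_le_right _ _
          _ = 1 := one_mul 1
      have hX : |X| ≤ M := hM _ hkm
      have hXm : X ∈ Icc (-(M + 1)) (M + 1) := abs_le.1 (by linarith)
      have hEm : E ∈ Icc (-(M + 1)) (M + 1) := abs_le.1 (by
        have := abs_add_le (E - X) X
        rw [sub_add_cancel] at this
        linarith)
      have hbE : |b E - b X| ≤ K * |E - X| := by
        simpa [Real.dist_eq] using hK.dist_le_mul E hEm X hXm
      have hint : |(∫ u in (k * h)..((k + 1) * h), b (x u)) - h * b X| ≤ K * η * h := by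
        have hc : Continuous fun u => b (x u) := hb.continuous.comp hx.cont
        have e : (∫ u in (k * h)..((k + 1) * h), b (x u)) - h * b X =
            ∫ u in (k * h)..((k + 1) * h), (b (x u) - b X) := by
          rw [intervalIntegral.integral_sub (hc.intervalIntegrable _ _) (by simp),
            intervalIntegral.integral_const, smul_eq_mul]
          ring
        rw [e]
        have := intervalIntegral.norm_integral_le_of_norm_le_const (a := k * h) (b := (k + 1) * h)
          (f := fun u => b (x u) - b X) (C := K * η) (fun u hu => by
            rw [uIoc_of_le hk0] at hu
            have hum : u ∈ Icc 0 t := ⟨hkm.1.trans hu.1.le, hu.2.trans hk1⟩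
            have h1 : dist (x u) X ≤ η := (hδ' u hum _ hkm (by
              rw [Real.dist_eq, abs_of_nonneg (by linarith [hu.1])]
              linarith [hu.2])).le
            have hxu : |x u| ≤ M := hM _ hum
            refine (hK.dist_le_mul _ (abs_le.1 (by linarith)) X hXm).trans ?_
            gcongr)
        rw [show ((k : ℝ) + 1) * h - k * h = h by ring, abs_of_nonneg hh] at this
        exact this
      have hxk := hx.sub_eq hb.continuous hkm hkm1
      have hstep : |euler b p (x 0) h (k + 1) - x ((k + 1) * h)| ≤
          (1 + K * h) * |E - X| + K * η * h := by
        have e : euler b p (x 0) h (k + 1) - x ((k + 1) * h) = (E - X) + h * (b E - b X) -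
            ((∫ u in (k * h)..((k + 1) * h), b (x u)) - h * b X) := by
          simp only [euler]
          linarith
        rw [e]
        calc _ ≤ |E - X| + |h * (b E - b X)| +
              |(∫ u in (k * h)..((k + 1) * h), b (x u)) - h * b X| :=
              (abs_sub _ _).trans (by gcongr; exact abs_add_le _ _)
          _ ≤ |E - X| + h * (K * |E - X|) + K * η * h := by
              rw [abs_mul, abs_of_nonneg hh]
              gcongr
          _ = _ := by ring
      push_cast
      calc _ ≤ (1 + K * h) * |E - X| + K * η * h := hstep
        _ ≤ Real.exp (K * h) * (k * h * K * η * Real.exp (K * (k * h))) + K * η * h * 1 := by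
          rw [mul_one]
          gcongr
          linarith [Real.add_one_le_exp (K * h)]
        _ ≤ Real.exp (K * h) * (k * h * K * η * Real.exp (K * (k * h))) +
            K * η * h * Real.exp (K * ((k + 1) * h)) := by
          gcongr
          exact Real.one_le_exp (by positivity)
        _ = _ := by
          rw [show (K : ℝ) * ((k + 1) * h) = K * h + K * (k * h) by ring, Real.exp_add]
          ring
  have := main N le_rfl
  rw [hNh] at this
  rw [Real.dist_eq]
  calc _ ≤ t * K * η * Real.exp (K * t) := this
    _ = (t * K) / (t * K + 1) * ε := by simp only [η]; field_simp
    _ ≤ 1 * (ε₀ / 2) := by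
      gcongr
      · rw [div_le_one (by positivity)]; linarith
      · exact min_le_left _ _
    _ < ε₀ := by linarith

/-- If `g` agrees with `b` above some level, and the equation with drift `b` has global solutions
started from all integers at all rational times, then the solutions of the equation with drift `g`
are bounded above on bounded time intervals. -/
lemma IsDriven.exists_upper_bound {b g p : ℝ → ℝ} (hb : LocallyLipschitz b) (hg : LocallyLipschitz g)
    (hp : Continuous p) {K : ℝ} (hK : ∀ z, K ≤ z → g z = b z)
    (hz : ∀ (j m : ℕ) (n : ℤ), ∃ z, (∀ T, IsDriven b p z (j / m) T) ∧ z (j / m) = n)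
    (x₀ : ℝ) (T : ℝ) :
    ∃ C, ∀ t ∈ Icc 0 T, ∀ x, IsDriven g p x 0 t → x 0 = x₀ → x t ≤ C := by
  obtain ⟨N, hN⟩ := exists_nat_ge (max K x₀)
  obtain ⟨L, hL⟩ := (isCompact_Icc (a := (N : ℝ)) (b := N + 1)).exists_bound_of_continuousOn
    hg.continuous.continuousOn
  obtain ⟨δ, hδ, hδ'⟩ := Metric.uniformContinuousOn_iff.1
    (isCompact_Icc.uniformContinuousOn_of_continuous (hp.continuousOn (s := Icc 0 T)))
    (1 / 2) (by norm_num)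
  -- Within a time `1 / m` the noise moves the path by less than `1/2`, and so does the drift while
  -- the path is in `[N, N + 1]`. A passage from `N` to `N + 1` thus lasts at least `1 / m`.
  obtain ⟨m, hm⟩ := exists_nat_gt (max (max (1 / δ) (2 * |L|)) 0)
  have hm0 : (0 : ℝ) < m := (le_max_right _ _).trans_lt hm
  have hmδ : 1 / (m : ℝ) < δ := by
    rw [one_div_lt hm0 hδ]
    exact (le_max_left _ _).trans_lt ((le_max_left _ _).trans_lt hm)
  have hmL : |L| * (1 / m) < 1 / 2 := by
    have : 2 * |L| < m := (le_max_right _ _).trans_lt ((le_max_left _ _).trans_lt hm)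
    rw [mul_one_div, div_lt_iff₀ hm0]
    linarith
  choose z hz hz0 using fun j : ℕ => hz j m (N + 1)
  choose C hC using fun j => (isCompact_Icc (a := 0) (b := T)).exists_bound_of_continuousOn
    ((hz j 0).cont.continuousOn (s := Icc 0 T))
  -- The sum dominates every comparison solution started at level `N + 1` at a grid time `j / m`
  -- that may be needed.
  refine ⟨N + 1 + ∑ j ∈ Finset.range (⌈T * m⌉₊ + 1), |C j|, fun t ht x hx hx0 => ?_⟩
  have hsum : 0 ≤ ∑ j ∈ Finset.range (⌈T * m⌉₊ + 1), |C j| :=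
    Finset.sum_nonneg fun _ _ => abs_nonneg _
  by_cases hxt : x t ≤ N + 1
  · linarith
  push Not at hxt
  have hxN : x 0 ≤ N := by rw [hx0]; exact (le_max_right _ _).trans hN
  -- the last visit to `N`
  obtain ⟨s, ⟨hsN, hs⟩, hsl⟩ :=
    (isCompact_Icc.inter_left (isClosed_eq hx.cont continuous_const) :
      IsCompact ({u | x u = N} ∩ Icc 0 t)).exists_isGreatest (by
        obtain ⟨u, hu, hu'⟩ := intermediate_value_Icc ht.1 hx.cont.continuousOn
          (show (N : ℝ) ∈ Icc _ _ from ⟨hxN, by linarith⟩)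
        exact ⟨u, hu', hu⟩)
  simp only [mem_ofPred_eq] at hsN
  have hNx : ∀ u ∈ Icc s t, (N : ℝ) ≤ x u := fun u hu => by
    by_contra! hlt
    obtain ⟨v, hv, hv'⟩ := intermediate_value_Icc hu.2 hx.cont.continuousOn
      (show (N : ℝ) ∈ Icc _ _ from ⟨hlt.le, by linarith⟩)
    have hvs := hsl ⟨hv', hs.1.trans (hu.1.trans hv.1), hv.2⟩
    have : u = s := le_antisymm (hv.1.trans hvs) hu.1
    rw [this, hsN] at hlt
    exact lt_irrefl _ hlt
  -- the first subsequent visit to `N + 1`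
  obtain ⟨r, ⟨hrN, hr⟩, hrl⟩ :=
    (isCompact_Icc.inter_left (isClosed_eq hx.cont continuous_const) :
      IsCompact ({u | x u = N + 1} ∩ Icc s t)).exists_isLeast (by
        obtain ⟨u, hu, hu'⟩ := intermediate_value_Icc hs.2 hx.cont.continuousOn
          (show (N + 1 : ℝ) ∈ Icc _ _ from ⟨by linarith, by linarith⟩)
        exact ⟨u, hu', hu⟩)
  simp only [mem_ofPred_eq] at hrN
  have hxr : ∀ u ∈ Icc s r, x u ≤ N + 1 := fun u hu => by
    by_contra! hlt
    obtain ⟨v, hv, hv'⟩ := intermediate_value_Icc hu.1 hx.cont.continuousOn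
      (show (N + 1 : ℝ) ∈ Icc _ _ from ⟨by linarith, hlt.le⟩)
    have hvr := hrl ⟨hv', hv.1, hv.2.trans (hu.2.trans hr.2)⟩
    have : u = r := le_antisymm hu.2 (hvr.trans hv.2)
    rw [this, hrN] at hlt
    exact lt_irrefl _ hlt
  have hlong : s + 1 / m ≤ r := by
    by_contra! hlt
    have h1 := hx.sub_eq hg.continuous hs ⟨hs.1.trans hr.1, hr.2⟩
    have h2 := intervalIntegral.norm_integral_le_of_norm_le_const (a := s) (b := r)
      (f := fun u => g (x u)) (C := |L|) (fun u hu => by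
        rw [uIoc_of_le hr.1] at hu
        exact (hL _ ⟨hNx u ⟨hu.1.le, hu.2.trans hr.2⟩, hxr u ⟨hu.1.le, hu.2⟩⟩).trans (le_abs_self _))
    have h3 := hδ' r ⟨hs.1.trans hr.1, hr.2.trans ht.2⟩ s ⟨hs.1, hs.2.trans ht.2⟩ (by
      rw [Real.dist_eq, abs_of_nonneg (by linarith [hr.1])]
      linarith)
    rw [Real.dist_eq] at h3
    rw [Real.norm_eq_abs, abs_of_nonneg (by linarith [hr.1] : 0 ≤ r - s)] at h2
    have h4 : |L| * (r - s) ≤ |L| * (1 / m) := by gcongr; linarith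
    have h5 := le_abs_self (∫ u in s..r, g (x u))
    have h6 := le_abs_self (p r - p s)
    rw [hrN, hsN] at h1
    linarith
  -- The first grid time after `s` falls in `[s, r]`, where `x ≤ N + 1`. From there on `x ≥ N ≥ K`,
  -- so `x` solves the equation with drift `b` and stays below the comparison solution.
  set j := ⌈s * m⌉₊
  have hsj : s ≤ (j : ℝ) / m := by rw [le_div_iff₀ hm0]; exact Nat.le_ceil _
  have hjr : (j : ℝ) / m ≤ r := by
    refine le_trans ?_ hlong
    rw [div_le_iff₀ hm0]
    have := Nat.ceil_lt_add_one (mul_nonneg hs.1 hm0.le)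
    field_simp
    linarith
  have hj : j ∈ Finset.range (⌈T * m⌉₊ + 1) := by
    rw [Finset.mem_range, Nat.lt_succ_iff]
    exact Nat.ceil_mono (by gcongr; exact hs.2.trans ht.2)
  have hxb : IsDriven b p x (j / m) t := (hx.mono hg.continuous (hs.1.trans hsj) le_rfl).congr_drift
    fun u hu => hK _ (((le_max_left _ _).trans hN).trans (hNx u ⟨hsj.trans hu.1, hu.2⟩))
  have hle := hxb.le_of_le_left hb (hz j t) (by
    rw [hz0]; push_cast; exact hxr _ ⟨hsj, hjr⟩) t ⟨hjr.trans hr.2, le_rfl⟩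
  have h7 := Finset.single_le_sum (f := fun j => |C j|) (fun _ _ => abs_nonneg _) hj
  have h8 := (le_abs_self _).trans ((hC j t ht).trans (le_abs_self _))
  have h9 : (0 : ℝ) ≤ N := N.cast_nonneg
  linarith

/-- The lower bound is the upper bound for the reflected equation, with drift `z ↦ -b (-z)` and
noise `-p`. -/
lemma IsDriven.exists_abs_bound {b g p : ℝ → ℝ} (hb : LocallyLipschitz b) (hg : LocallyLipschitz g)
    (hp : Continuous p) {K : ℝ} (hK : ∀ z, K ≤ |z| → g z = b z)
    (hz : ∀ (j m : ℕ) (n : ℤ), ∃ z, (∀ T, IsDriven b p z (j / m) T) ∧ z (j / m) = n)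
    (x₀ : ℝ) (T : ℝ) :
    ∃ C, ∀ t ∈ Icc 0 T, ∀ x, IsDriven g p x 0 t → x 0 = x₀ → |x t| ≤ C := by
  have hneg : ∀ {h : ℝ → ℝ}, LocallyLipschitz h → LocallyLipschitz fun z => -h (-z) := fun hh =>
    (LipschitzWith.neg LipschitzWith.id).locallyLipschitz.comp
      (hh.comp (LipschitzWith.neg LipschitzWith.id).locallyLipschitz)
  obtain ⟨C₁, h₁⟩ := exists_upper_bound hb hg hp (fun z h => hK z (h.trans (le_abs_self z))) hz x₀ T
  obtain ⟨C₂, h₂⟩ := exists_upper_bound (hneg hb) (hneg hg) hp.neg (K := K)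
    (fun z h => by rw [hK (-z) (by rw [abs_neg]; exact h.trans (le_abs_self z))])
    (fun j m n => by
      obtain ⟨z, hz, hz'⟩ := hz j m (-n)
      exact ⟨fun u => -z u, fun T => (hz T).neg, by simp [hz']⟩) (-x₀) T
  refine ⟨max C₁ C₂, fun t ht x hx hx0 => abs_le.2 ⟨?_, (h₁ t ht x hx hx0).trans (le_max_left _ _)⟩⟩
  have := (h₂ t ht _ hx.neg (by rw [hx0])).trans (le_max_right C₁ C₂)
  linarith

/-! ### Strong solutions -/

section Strong

variable {Ω : Type} {B : ℝ≥0 → Ω → ℝ} {b : ℝ → ℝ}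

/-- The path `s ↦ √2 B_s`, extended to negative times. -/
noncomputable def noise (B : ℝ≥0 → Ω → ℝ) (w : Ω) (s : ℝ) : ℝ := √2 * B s.toNNReal w

lemma continuous_noise {w : Ω} (h : Continuous fun t => B t w) : Continuous (noise B w) :=
  continuous_const.mul (h.comp continuous_real_toNNReal)

lemma measurable_euler {m : MeasurableSpace Ω} (hb : Continuous b) {h : ℝ} {c : Ω → ℝ}
    (hc : Measurable[m] c) (N : ℕ) (hB : ∀ k ≤ N, Measurable[m] (B ((k : ℝ) * h).toNNReal)) :
    ∀ k ≤ N, Measurable[m] fun w => euler b (noise B w) (c w) h k := by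
  intro k
  induction k with
  | zero => exact fun _ => hc
  | succ k ih =>
    intro hk
    have h1 := ih (by omega)
    have h2 := hB k (by omega)
    have h3 := hB (k + 1) hk
    push_cast at h3
    simp only [euler, noise]
    exact (h1.add ((hb.measurable.comp h1).const_mul h)).add ((h3.const_mul _).sub (h2.const_mul _))

variable [MeasurableSpace Ω] {P : Measure Ω} {x₀ : ℝ}

/-- `IsDriven` only sees increments of the noise, so `√2 * B 0 w` moves into the initial condition
and `B 0 = 0` is never needed. -/
lemma IsStrongSolution.ae_isDriven {X : ℝ≥0 → Ω → ℝ} (hX : IsStrongSolution P B b x₀ X) :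
    ∀ᵐ w ∂P, (∀ T, IsDriven b (noise B w) (fun s => X s.toNNReal w) 0 T) ∧
      X 0 w = x₀ + √2 * B 0 w := by
  filter_upwards [hX.continuous, hX.equation] with w hc he
  have h0 : X 0 w = x₀ + √2 * B 0 w := by simpa using he 0
  refine ⟨fun T => ⟨hc.comp continuous_real_toNNReal, fun r hr => ?_⟩, h0⟩
  have := he r.toNNReal
  rw [Real.coe_toNNReal r hr.1] at this
  simp only [noise, Real.toNNReal_zero, h0]
  rw [this]
  ring

/-- With additive noise, existence and uniqueness are deterministic statements about almost every
path. Only adaptedness is probabilistic, and it follows from convergence of the Euler scheme. -/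
lemma exists_unique_isStrongSolution (hb : LocallyLipschitz b) (hB : IsBrownianReal B P)
    (h : ∀ᵐ w ∂P, ∀ T : ℝ, 0 ≤ T → ∃ C, ∀ t ∈ Icc 0 T, ∀ x, IsDriven b (noise B w) x 0 t →
      x 0 = x₀ + √2 * B 0 w → |x t| ≤ C) :
    ∃ X : ℝ≥0 → Ω → ℝ, IsStrongSolution P B b x₀ X ∧
      ∀ Y : ℝ≥0 → Ω → ℝ, IsStrongSolution P B b x₀ Y → ∀ᵐ w ∂P, ∀ t, Y t w = X t w := by
  -- Paths without a global solution receive the value `0`, so that a choice can be made for every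
  -- `w`.
  have hex : ∀ w, ∃ x : ℝ → ℝ, (∃ x, (∀ T, IsDriven b (noise B w) x 0 T) ∧
      x 0 = x₀ + √2 * B 0 w) → (∀ T, IsDriven b (noise B w) x 0 T) ∧ x 0 = x₀ + √2 * B 0 w := by
    intro w
    by_cases hw : ∃ x, (∀ T, IsDriven b (noise B w) x 0 T) ∧ x 0 = x₀ + √2 * B 0 w
    · exact ⟨hw.choose, fun _ => hw.choose_spec⟩
    · exact ⟨0, fun h => absurd h hw⟩
  choose x hx using hex
  have hae : ∀ᵐ w ∂P, (∀ T, IsDriven b (noise B w) (x w) 0 T) ∧ x w 0 = x₀ + √2 * B 0 w := by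
    filter_upwards [h, hB.cont] with w hw hc
    exact hx w (exists_isDriven_forall hb (continuous_noise hc) _ hw)
  refine ⟨fun t w => x w t, ⟨fun t => ?_, ?_, ?_⟩, fun Y hY => ?_⟩
  · set m : MeasurableSpace Ω := ⨆ s ≤ t, MeasurableSpace.comap (B s) inferInstance
    have hm : ∀ s ≤ t, Measurable[m] (B s) := fun s hs =>
      (comap_measurable (B s)).mono (le_iSup₂_of_le s hs le_rfl) le_rfl
    -- This version of the time-`t` value is measurable for the noise up to `t` and agrees almost
    -- surely with the solution.
    refine ⟨fun w => limUnder atTop fun N : ℕ => euler b (noise B w) (x₀ + √2 * B 0 w) (t / N) N,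
      StronglyMeasurable.limUnder fun N => ?_, ?_⟩
    · refine Measurable.stronglyMeasurable (measurable_euler hb.continuous
        (measurable_const.add ((hm 0 zero_le).const_mul _)) N (fun k hk => hm _ ?_) N le_rfl)
      rw [Real.toNNReal_le_iff_le_coe]
      rcases N.eq_zero_or_pos with rfl | hN
      · simp
      · have hN' : (0 : ℝ) < N := by exact_mod_cast hN
        have hk' : (k : ℝ) ≤ N := by exact_mod_cast hk
        calc (k : ℝ) * (t / N) ≤ N * (t / N) := by gcongr
          _ = t := by field_simp
    · filter_upwards [hae] with w hw
      have := tendsto_euler hb t.2 (hw.1 t)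
      rw [hw.2] at this
      exact this.limUnder_eq.symm
  · filter_upwards [hae] with w hw
    exact (hw.1 0).cont.comp NNReal.continuous_coe
  · filter_upwards [hae] with w hw t
    have h1 := (hw.1 t).eq t ⟨t.2, le_rfl⟩
    have h2 : ∫ s in (0 : ℝ)..t, b (x w s.toNNReal) = ∫ s in (0 : ℝ)..t, b (x w s) := by
      refine intervalIntegral.integral_congr fun s hs => ?_
      rw [uIcc_of_le t.coe_nonneg] at hs
      simp only [Real.coe_toNNReal s hs.1]
    rw [h1, h2, hw.2]
    simp only [noise, Real.toNNReal_coe, Real.toNNReal_zero]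
    ring
  · filter_upwards [hae, hY.ae_isDriven] with w hw hyw t
    simpa using (hyw.1 t).eq_of_eq_left hb (hw.1 t) (by simp [hyw.2, hw.2]) t ⟨t.2, le_rfl⟩

end Strong

/-- Bounded locally Lipschitz drifts are well posed. -/
lemma stronglyWellPosed_of_bounded {b : ℝ → ℝ} (hb : LocallyLipschitz b) {C : ℝ}
    (hC : ∀ z, |b z| ≤ C) : StronglyWellPosed b := by
  intro x₀ Ω _ P _ B _ hB
  refine exists_unique_isStrongSolution hb hB ?_
  filter_upwards [hB.cont] with w hw T hT
  obtain ⟨M, hM⟩ := (isCompact_Icc (a := 0) (b := T)).exists_bound_of_continuousOn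
    ((continuous_noise hw).continuousOn)
  have hC0 : 0 ≤ C := (abs_nonneg _).trans (hC 0)
  refine ⟨|x₀ + √2 * B 0 w| + C * T + (M + M), fun t ht x hx hx0 => ?_⟩
  rw [hx.eq t ⟨ht.1, le_rfl⟩, hx0]
  have h1 := intervalIntegral.norm_integral_le_of_norm_le_const (a := 0) (b := t)
    (f := fun u => b (x u)) (C := C) (fun u _ => hC _)
  rw [sub_zero, abs_of_nonneg ht.1] at h1
  refine (abs_add_le _ _).trans (add_le_add ((abs_add_le _ _).trans
    (add_le_add le_rfl (h1.trans (by gcongr; exact ht.2)))) ((abs_sub _ _).trans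
      (add_le_add (hM t ht) (hM 0 ⟨le_rfl, hT⟩))))

/-- Strong well-posedness is stable under compactly supported perturbations of the drift. -/
lemma StronglyWellPosed.of_eq_off_compact {b g : ℝ → ℝ} (hwp : StronglyWellPosed b)
    (hb : LocallyLipschitz b) (hg : LocallyLipschitz g) {K : ℝ} (hK : ∀ z, K ≤ |z| → g z = b z) :
    StronglyWellPosed g := by
  intro x₀ Ω _ P _ B hBm hB
  refine exists_unique_isStrongSolution hg hB ?_
  -- Each comparison solution comes from well-posedness for the shifted Brownian motion `B (q + ·) -
  -- B q`. There are countably many, so they exist simultaneously almost surely.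
  have key : ∀ᵐ w ∂P, ∀ (j m : ℕ) (n : ℤ), ∃ z,
      (∀ T, IsDriven b (noise B w) z (j / m) T) ∧ z (j / m) = n := by
    simp only [ae_all_iff]
    intro j m n
    set q : ℝ≥0 := j / m
    obtain ⟨X, hX, -⟩ := hwp n Ω P (fun t w => B (q + t) w - B q w)
      (fun t => (hBm _).sub (hBm _)) (hB.shift q)
    filter_upwards [hX.ae_isDriven] with w hw
    have hq : ((j : ℝ) / m) = q := by simp [q]
    rw [hq]
    refine ⟨fun u => X (u - q).toNNReal w, fun T => ⟨?_, fun r hr => ?_⟩, by simpa using hw.2⟩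
    · exact (hw.1 0).cont.comp (by fun_prop : Continuous fun u : ℝ => u - q)
    · have h1 := (hw.1 (r - q)).eq (r - q) ⟨by linarith [hr.1], le_rfl⟩
      have h2 := intervalIntegral.integral_comp_sub_right (a := (q : ℝ)) (b := r)
        (fun u => b (X u.toNNReal w)) q
      rw [sub_self] at h2 ⊢
      rw [h2, h1]
      have h3 : q + (r - q).toNNReal = r.toNNReal := by
        ext
        rw [NNReal.coe_add, Real.coe_toNNReal _ (by linarith [hr.1]),
          Real.coe_toNNReal _ (q.2.trans hr.1)]
        ring
      simp only [noise, h3, Real.toNNReal_coe, Real.toNNReal_zero, add_zero]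
      ring
  filter_upwards [key, hB.cont] with w hw hc T _
  exact IsDriven.exists_abs_bound hb hg (continuous_noise hc) hK hw _ T

/-! ### Calculus on the two state spaces -/

/-- Periodicity on the torus, no condition on the line. -/
def Dom.Per : Dom → (ℝ → ℝ) → Prop
  | .line, _ => True
  | .torus, u => Function.Periodic u (2 * Real.pi)

namespace Dom

variable {D : Dom} {u v u' η : ℝ → ℝ}

lemma smooth_iff : D.Smooth u ↔ ContDiff ℝ ∞ u ∧ D.Per u := by
  cases D <;> simp [Smooth, Per]

lemma Per.comp (F : ℝ → ℝ) (hu : D.Per u) : D.Per fun x => F (u x) := by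
  cases D
  · trivial
  · exact fun x => congrArg F (hu x)

lemma Per.comp₂ (F : ℝ → ℝ → ℝ) (hu : D.Per u) (hv : D.Per v) : D.Per fun x => F (u x) (v x) := by
  cases D
  · trivial
  · exact fun x => congrArg₂ F (hu x) (hv x)

lemma Per.deriv (hu : D.Per u) : D.Per (deriv u) := by
  cases D
  · trivial
  · intro x
    rw [← deriv_comp_add_const]
    exact congrFun (congrArg _root_.deriv (funext hu)) x

lemma SmoothCompact.smooth (hη : D.SmoothCompact η) : D.Smooth η := by
  cases D
  · exact hη.1
  · exact hη

lemma SmoothCompact.contDiff (hη : D.SmoothCompact η) : ContDiff ℝ ∞ η :=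
  (smooth_iff.1 hη.smooth).1

lemma SmoothCompact.continuous (hη : D.SmoothCompact η) : Continuous η := hη.contDiff.continuous

lemma SmoothCompact.deriv (hη : D.SmoothCompact η) : D.SmoothCompact (deriv η) := by
  have h := (contDiff_infty_iff_deriv.1 hη.contDiff).2
  cases D
  · exact ⟨h, hη.2.deriv⟩
  · exact ⟨h, Per.deriv (D := .torus) hη.2⟩

lemma SmoothCompact.mul_left (hu : D.Smooth u) (hη : D.SmoothCompact η) :
    D.SmoothCompact fun x => u x * η x := by
  have hc := (smooth_iff.1 hu).1.mul hη.contDiff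
  cases D
  · exact ⟨hc, hη.2.mul_left⟩
  · exact ⟨hc, Per.comp₂ (D := .torus) (· * ·) hu.2 hη.2⟩

lemma SmoothCompact.add (hu : D.SmoothCompact u) (hv : D.SmoothCompact v) :
    D.SmoothCompact fun x => u x + v x := by
  cases D
  · exact ⟨hu.1.add hv.1, hu.2.add hv.2⟩
  · exact ⟨hu.1.add hv.1, Per.comp₂ (D := .torus) (· + ·) hu.2 hv.2⟩

lemma Smooth.const (c : ℝ) : D.Smooth fun _ => c := by
  rw [smooth_iff]
  exact ⟨contDiff_const, by cases D <;> simp [Per]⟩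

lemma SmoothCompact.bounded (hη : D.SmoothCompact η) : ∃ C, ∀ x, |η x| ≤ C := by
  cases D
  · exact hη.2.exists_bound_of_continuous hη.1.continuous
  · obtain ⟨C, hC⟩ := (isCompact_Icc (a := 0) (b := 2 * Real.pi)).exists_bound_of_continuousOn
      hη.1.continuous.continuousOn
    refine ⟨C, fun x => ?_⟩
    obtain ⟨y, hy, hxy⟩ := hη.2.exists_mem_Ico₀ Real.two_pi_pos x
    rw [hxy]
    exact hC y (Ico_subset_Icc_self hy)

instance : NeZero D.vol := by
  refine ⟨fun h => ?_⟩
  cases D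
  · exact NeZero.ne (volume : Measure ℝ) h
  · have := congrArg (fun μ => μ univ) h
    simp only [vol, Measure.restrict_apply_univ, Real.volume_Ioc, Measure.coe_zero, Pi.zero_apply,
      ENNReal.ofReal_eq_zero] at this
    linarith [Real.pi_pos]

instance : IsLocallyFiniteMeasure D.vol := by
  cases D <;> simp only [vol] <;> infer_instance

lemma integral_torus (u : ℝ → ℝ) : ∫ x, u x ∂Dom.torus.vol = ∫ x in -Real.pi..Real.pi, u x := by
  rw [intervalIntegral.integral_of_le (by linarith [Real.pi_pos])]
  rfl

lemma integrable_torus (hu : LocallyIntegrable u Dom.torus.vol) : Integrable u Dom.torus.vol := by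
  have := hu.integrableOn_isCompact (isCompact_Icc (a := -Real.pi) (b := Real.pi))
  rw [IntegrableOn, vol, Measure.restrict_restrict measurableSet_Icc,
    inter_eq_right.2 Ioc_subset_Icc_self] at this
  exact this

lemma integrable_mul_test (hu : LocallyIntegrable u D.vol) (hη : D.SmoothCompact η) :
    Integrable (fun x => u x * η x) D.vol := by
  obtain ⟨C, hC⟩ := hη.bounded
  cases D
  · have := hu.integrable_smul_left_of_hasCompactSupport hη.1.continuous hη.2
    simpa [mul_comm] using this
  · exact (integrable_torus hu).mul_bdd hη.1.continuous.aestronglyMeasurable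
      (ae_of_all _ fun x => hC x)

/-- Integration by parts against a test function. -/
lemma integral_mul_deriv_test (hu : ∀ x, HasDerivAt u (u' x) x) (hu' : Continuous u')
    (hper : D.Per u) (hη : D.SmoothCompact η) :
    ∫ x, u x * deriv η x ∂D.vol = -∫ x, u' x * η x ∂D.vol := by
  have hu₀ : Continuous u := continuous_iff_continuousAt.2 fun x => (hu x).continuousAt
  have hηd : ∀ x, HasDerivAt η (deriv η x) x := fun x =>
    (hη.contDiff.differentiable (by simp) x).hasDerivAt
  have hη' := hη.deriv.continuous
  have i₁ := integrable_mul_test (D := D) hu₀.locallyIntegrable hη.deriv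
  have i₂ := integrable_mul_test (D := D) hu'.locallyIntegrable hη
  have i₃ := integrable_mul_test (D := D) hu₀.locallyIntegrable hη
  cases D
  · exact integral_mul_deriv_eq_deriv_mul_of_integrable (fun x _ => hu x) (fun x _ => hηd x) i₁ i₂ i₃
  · rw [integral_torus, integral_torus, intervalIntegral.integral_mul_deriv_eq_deriv_mul
      (fun x _ => hu x) (fun x _ => hηd x) (hu'.intervalIntegrable _ _)
      (hη'.intervalIntegrable _ _)]
    have h1 := hper (-Real.pi)
    have h2 := hη.2 (-Real.pi)
    rw [show -Real.pi + 2 * Real.pi = Real.pi by ring] at h1 h2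
    rw [h1, h2]
    ring

/-- Smooth cutoff functions. -/
lemma exists_cutoff (D : Dom) : ∃ χ : ℕ → ℝ → ℝ, (∀ n, D.SmoothCompact (χ n)) ∧
    (∀ n x, 0 ≤ χ n x) ∧ (∀ n x, χ n x ≤ 1) ∧ ∀ (n : ℕ) (x : ℝ), |x| ≤ n → χ n x = 1 := by
  cases D
  · let β : ℕ → ContDiffBump (0 : ℝ) := fun n => ⟨n + 1, n + 2, by positivity, by linarith⟩
    refine ⟨fun n => β n, fun n => ⟨(β n).contDiff, (β n).hasCompactSupport⟩,
      fun n x => (β n).nonneg, fun n x => (β n).le_one, fun n x hx => (β n).one_of_mem_closedBall ?_⟩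
    simp only [Metric.mem_closedBall, dist_zero_right, Real.norm_eq_abs, β]
    linarith
  · exact ⟨fun _ _ => 1, fun _ => Smooth.const (D := .torus) 1, by simp, by simp, by simp⟩

/-- The `2π`-periodic extension of a smooth function compactly supported in `(-π, π)`. -/
lemma exists_periodic_extension {g : ℝ → ℝ} (hg : ContDiff ℝ ∞ g)
    (hs : tsupport g ⊆ Ioo (-Real.pi) Real.pi) :
    ∃ η, Dom.torus.SmoothCompact η ∧ ∀ x ∈ Ioc (-Real.pi) Real.pi, η x = g x := by
  have hpi := Real.pi_pos
  set r : ℝ → ℝ := toIocMod Real.two_pi_pos (-Real.pi)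
  have hr : ∀ x ∈ Ioc (-Real.pi) Real.pi, r x = x := fun x hx =>
    (toIocMod_eq_self Real.two_pi_pos).2 (by
      rwa [show -Real.pi + 2 * Real.pi = Real.pi by ring])
  have hper : Function.Periodic (fun x => g (r x)) (2 * Real.pi) := fun x => by
    simp only [r, toIocMod_add_right]
  refine ⟨fun x => g (r x), ⟨contDiff_iff_contDiffAt.2 fun x => ?_, hper⟩, fun x hx => by
    simp only [hr x hx]⟩
  -- Only the seam `x = π` is delicate; there `g` vanishes near both `π` and `-π`. Other points
  -- reduce to this interval by translation.
  have key : ∀ x ∈ Ioc (-Real.pi) Real.pi, ContDiffAt ℝ ∞ (fun x => g (r x)) x := by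
    intro x hx
    rcases hx.2.lt_or_eq with hlt | rfl
    · refine hg.contDiffAt.congr_of_eventuallyEq ?_
      filter_upwards [Ioo_mem_nhds hx.1 hlt] with y hy
      rw [hr y ⟨hy.1, hy.2.le⟩]
    · have h1 : ∀ᶠ y in 𝓝 Real.pi, g y = 0 :=
        notMem_tsupport_iff_eventuallyEq.1 fun h => lt_irrefl _ (hs h).2
      have h2 : ∀ᶠ y in 𝓝 (Real.pi - 2 * Real.pi), g y = 0 := by
        rw [show Real.pi - 2 * Real.pi = -Real.pi by ring]
        exact notMem_tsupport_iff_eventuallyEq.1 fun h => lt_irrefl _ (hs h).1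
      have h3 : ∀ᶠ y in 𝓝 Real.pi, g (y - 2 * Real.pi) = 0 :=
        ((continuous_id.sub continuous_const).tendsto Real.pi).eventually h2
      refine (contDiffAt_const (c := (0 : ℝ))).congr_of_eventuallyEq ?_
      filter_upwards [h1, h3, Ioo_mem_nhds (by linarith : -Real.pi < Real.pi)
        (by linarith : Real.pi < 3 * Real.pi)] with y hy1 hy3 hy
      rcases le_or_gt y Real.pi with hle | hlt
      · rw [hr y ⟨hy.1, hle⟩, hy1]
      · have := hper (y - 2 * Real.pi)
        simp only [sub_add_cancel] at this
        rw [this, hr _ ⟨by linarith, by linarith [hy.2]⟩, hy3]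
  have hx := toIocMod_mem_Ioc Real.two_pi_pos (-Real.pi) x
  rw [show -Real.pi + 2 * Real.pi = Real.pi by ring] at hx
  have h := key _ hx
  set k := toIocDiv Real.two_pi_pos (-Real.pi) x
  have hxk : x - k • (2 * Real.pi) = toIocMod Real.two_pi_pos (-Real.pi) x :=
    self_sub_toIocDiv_zsmul _ _ _
  have e : (fun x => g (r x)) = (fun x => g (r x)) ∘ fun y => y - k • (2 * Real.pi) := by
    funext y
    exact (hper.sub_zsmul_eq k).symm
  rw [e]
  refine ContDiffAt.comp x ?_ (by fun_prop)
  rw [hxk]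
  exact h

/-- A locally integrable function which is orthogonal to the test functions vanishes. -/
lemma ae_eq_zero_of_integral_test (hu : LocallyIntegrable u D.vol)
    (h : ∀ η, D.SmoothCompact η → ∫ x, u x * η x ∂D.vol = 0) : ∀ᵐ x ∂D.vol, u x = 0 := by
  cases D
  · refine ae_eq_zero_of_integral_contDiff_smul_eq_zero hu fun g hg hc => ?_
    simpa [mul_comm, vol] using h g ⟨hg, hc⟩
  · have hI : Integrable u (volume.restrict (Ioc (-Real.pi) Real.pi)) := integrable_torus hu
    have := isOpen_Ioo.ae_eq_zero_of_integral_contDiff_smul_eq_zero (μ := volume) (f := u)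
      (U := Ioo (-Real.pi) Real.pi) (IntegrableOn.mono_set hI Ioo_subset_Ioc_self).locallyIntegrableOn
      (fun g hg hc hs => by
        obtain ⟨η, hη, hηg⟩ := exists_periodic_extension hg hs
        have h0 := h η hη
        rw [vol, setIntegral_congr_fun (g := fun x => g x • u x) measurableSet_Ioc (fun x hx => by
          simp only [hηg x hx, smul_eq_mul, mul_comm])] at h0
        rwa [setIntegral_eq_integral_of_forall_compl_eq_zero] at h0
        intro x hx
        have : g x = 0 := image_eq_zero_of_notMem_tsupport fun hx' =>
          hx (Ioo_subset_Ioc_self (hs hx'))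
        simp [this])
    rw [vol, Measure.restrict_congr_set Ioo_ae_eq_Ioc.symm, ae_restrict_iff' measurableSet_Ioo]
    exact this

end Dom

lemma hasDerivAt_primitive {u : ℝ → ℝ} (hu : Continuous u) (x : ℝ) :
    HasDerivAt (fun x => ∫ y in (0 : ℝ)..x, u y) (u x) x :=
  (hu.integral_hasStrictDerivAt 0 x).hasDerivAt

/-- Primitives of smooth functions are smooth. -/
lemma contDiff_primitive {u : ℝ → ℝ} (hu : ContDiff ℝ ∞ u) :
    ContDiff ℝ ∞ fun x => ∫ y in (0 : ℝ)..x, u y := by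
  rw [contDiff_infty_iff_deriv]
  have h := hasDerivAt_primitive hu.continuous
  refine ⟨fun x => (h x).differentiableAt, ?_⟩
  rwa [show deriv (fun x => ∫ y in (0 : ℝ)..x, u y) = u from funext fun x => (h x).deriv]

lemma Dom.Per.primitive {D : Dom} {u : ℝ → ℝ} (hc : Continuous u) (hu : D.Per u)
    (h0 : D = .torus → ∫ x, u x ∂D.vol = 0) : D.Per fun x => ∫ y in (0 : ℝ)..x, u y := by
  cases D
  · trivial
  · intro x
    have h1 := hu.intervalIntegral_add_eq x (-Real.pi)
    rw [show -Real.pi + 2 * Real.pi = Real.pi by ring, ← Dom.integral_torus, h0 rfl] at h1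
    have h2 := intervalIntegral.integral_add_adjacent_intervals (hc.intervalIntegrable (μ := volume) 0 x)
      (hc.intervalIntegrable x (x + 2 * Real.pi))
    simp only
    rw [← h2, h1, add_zero]

section Gibbs

variable {D : Dom} {W V U f φ φ' : ℝ → ℝ}

/-! ### Gibbs measures -/

lemma partition_pos (hi : Integrable (fun x => Real.exp (-W x)) D.vol) : 0 < partition D W :=
  integral_exp_pos hi

lemma measurable_gibbs_density (hW : Continuous W) :
    Measurable fun x => ENNReal.ofReal (Real.exp (-W x) / partition D W) := by
  have : Continuous fun x => Real.exp (-W x) / partition D W := by fun_prop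
  exact this.measurable.ennreal_ofReal

lemma ae_gibbs (hW : Continuous W) (hi : Integrable (fun x => Real.exp (-W x)) D.vol) :
    ae (gibbs D W) = ae D.vol := by
  refine le_antisymm (withDensity_absolutelyContinuous _ _).ae_le
    (withDensity_absolutelyContinuous' (measurable_gibbs_density hW).aemeasurable
      (ae_of_all _ fun x => ?_)).ae_le
  have := partition_pos hi
  rw [ne_eq, ENNReal.ofReal_eq_zero, not_le]
  positivity

lemma aestronglyMeasurable_gibbs_iff (hW : Continuous W)
    (hi : Integrable (fun x => Real.exp (-W x)) D.vol) :
    AEStronglyMeasurable φ (gibbs D W) ↔ AEStronglyMeasurable φ D.vol := by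
  have h := ae_gibbs hW hi
  constructor <;> rintro ⟨g, hg, hg'⟩ <;> refine ⟨g, hg, ?_⟩ <;>
    simpa only [EventuallyEq, h] using hg'

lemma integral_gibbs (hW : Continuous W) (hi : Integrable (fun x => Real.exp (-W x)) D.vol)
    (g : ℝ → ℝ) :
    ∫ x, g x ∂(gibbs D W) = (∫ x, g x * Real.exp (-W x) ∂D.vol) / partition D W := by
  have hZ := partition_pos hi
  rw [gibbs, integral_withDensity_eq_integral_toReal_smul (measurable_gibbs_density hW)
    (ae_of_all _ fun x => ENNReal.ofReal_lt_top), ← integral_div]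
  refine integral_congr_ae (ae_of_all _ fun x => ?_)
  simp only
  rw [ENNReal.toReal_ofReal (by positivity), smul_eq_mul]
  ring

lemma integrable_gibbs_iff (hW : Continuous W) (hi : Integrable (fun x => Real.exp (-W x)) D.vol) :
    Integrable φ (gibbs D W) ↔ Integrable (fun x => φ x * Real.exp (-W x)) D.vol := by
  have hZ := partition_pos hi
  rw [gibbs, integrable_withDensity_iff_integrable_smul' (measurable_gibbs_density hW)
    (ae_of_all _ fun x => ENNReal.ofReal_lt_top),
    ← integrable_const_mul_iff (isUnit_iff_ne_zero.2 (inv_ne_zero hZ.ne'))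
      (fun x => φ x * Real.exp (-W x))]
  refine integrable_congr (ae_of_all _ fun x => ?_)
  simp only
  rw [ENNReal.toReal_ofReal (by positivity), smul_eq_mul]
  ring

lemma memLp_gibbs_iff (hW : Continuous W) (hi : Integrable (fun x => Real.exp (-W x)) D.vol) :
    MemLp φ 2 (gibbs D W) ↔ AEStronglyMeasurable φ D.vol ∧
      Integrable (fun x => φ x ^ 2 * Real.exp (-W x)) D.vol := by
  rw [← integrable_gibbs_iff (φ := fun x => φ x ^ 2) hW hi, ← aestronglyMeasurable_gibbs_iff hW hi]
  exact ⟨fun h => ⟨h.1, (memLp_two_iff_integrable_sq h.1).1 h⟩,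
    fun h => (memLp_two_iff_integrable_sq h.1).2 h.2⟩

lemma isProbabilityMeasure_gibbs (hW : Continuous W)
    (hi : Integrable (fun x => Real.exp (-W x)) D.vol) : IsProbabilityMeasure (gibbs D W) := by
  have hZ := partition_pos hi
  have h1 : Integrable (fun _ : ℝ => (1 : ℝ)) (gibbs D W) := by
    rw [integrable_gibbs_iff hW hi]; simpa using hi
  have : IsFiniteMeasure (gibbs D W) := by
    simpa [integrable_const_iff] using h1
  have h2 := integral_gibbs hW hi fun _ => 1
  simp only [integral_const, smul_eq_mul, mul_one, one_mul] at h2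
  rw [← partition, div_self hZ.ne'] at h2
  refine ⟨?_⟩
  rwa [Measure.real, ENNReal.toReal_eq_one_iff] at h2

/-- On compact sets the weight is bounded below, so weighted square integrability implies the
unweighted one. -/
lemma locallyIntegrable_of_memLp_gibbs (hW : Continuous W)
    (hi : Integrable (fun x => Real.exp (-W x)) D.vol) (hφ : MemLp φ 2 (gibbs D W)) :
    LocallyIntegrable φ D.vol := by
  obtain ⟨hm, hI⟩ := (memLp_gibbs_iff hW hi).1 hφ
  rw [locallyIntegrable_iff]
  intro k hk
  have h1 : IntegrableOn (fun x => φ x ^ 2 * Real.exp (-W x) * Real.exp (W x)) k D.vol :=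
    hI.integrableOn.mul_continuousOn (by fun_prop) hk
  have h2 : IntegrableOn (fun x => φ x ^ 2) k D.vol := by
    refine h1.congr_fun_ae (ae_of_all _ fun x => ?_)
    simp only
    rw [mul_assoc, ← Real.exp_add, neg_add_cancel, Real.exp_zero, mul_one]
  have h3 : IntegrableOn (fun x => 1 + φ x ^ 2) k D.vol :=
    (integrableOn_const hk.measure_lt_top.ne).add h2
  refine Integrable.mono' h3 hm.restrict (ae_of_all _ fun x => ?_)
  rw [Real.norm_eq_abs, abs_le]
  constructor <;> nlinarith [sq_nonneg (φ x - 1), sq_nonneg (φ x + 1)]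

/-! ### The Poincaré inequality -/

lemma IsWeakDeriv.sub_const (hφ : LocallyIntegrable φ D.vol) (h : IsWeakDeriv D φ φ') (c : ℝ) :
    IsWeakDeriv D (fun x => φ x - c) φ' := by
  intro η hη
  have h0 := Dom.integral_mul_deriv_test (D := D) (fun x => hasDerivAt_const x (1 : ℝ))
    continuous_const (Dom.smooth_iff.1 (Dom.Smooth.const 1)).2 hη
  simp only [one_mul, zero_mul, integral_zero, neg_zero] at h0
  have hc : Continuous fun _ : ℝ => (1 : ℝ) := continuous_const
  have h1 := Dom.integrable_mul_test (hc.locallyIntegrable (μ := D.vol)) hη.deriv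
  simp only [one_mul] at h1
  simp_rw [sub_mul]
  rw [integral_sub (Dom.integrable_mul_test hφ hη.deriv) (h1.const_mul c), integral_const_mul, h0,
    mul_zero, sub_zero, h η hη]

lemma isWeakDeriv_of_hasDerivAt (h : ∀ x, HasDerivAt φ (φ' x) x) (h' : Continuous φ')
    (hp : D.Per φ) : IsWeakDeriv D φ φ' :=
  fun _ hη => Dom.integral_mul_deriv_test h h' hp hη

lemma memH1Zero_sub_mean (hW : Continuous W) (hi : Integrable (fun x => Real.exp (-W x)) D.vol)
    (hφ : MemLp φ 2 (gibbs D W)) (hφ' : MemLp φ' 2 (gibbs D W)) (h : IsWeakDeriv D φ φ') :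
    MemH1Zero D (gibbs D W) (fun x => φ x - mean D W φ) φ' := by
  have := isProbabilityMeasure_gibbs hW hi
  refine ⟨hφ.sub (memLp_const _), ?_, hφ', h.sub_const (locallyIntegrable_of_memLp_gibbs hW hi hφ) _⟩
  rw [integral_sub (hφ.integrable (by norm_num)) (integrable_const _)]
  simp [mean]

lemma integrable_mul_exp_add_iff (hU : Continuous U) {C : ℝ} (hC : ∀ x, |U x| ≤ C) :
    Integrable (fun x => φ x * Real.exp (-(V + U) x)) D.vol ↔
      Integrable (fun x => φ x * Real.exp (-V x)) D.vol := by
  have key : ∀ u v : ℝ → ℝ, Continuous u → (∀ x, |u x| ≤ C) →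
      Integrable (fun x => φ x * Real.exp (-v x)) D.vol →
      Integrable (fun x => φ x * Real.exp (-(v + u) x)) D.vol := by
    intro u v hu hC h
    have := h.mul_bdd (c := Real.exp C) (g := fun x => Real.exp (-u x))
      (Continuous.aestronglyMeasurable (by fun_prop)) (ae_of_all _ fun x => by
        rw [Real.norm_eq_abs, Real.abs_exp]
        exact Real.exp_le_exp.2 ((neg_le_abs _).trans (hC x)))
    refine this.congr (ae_of_all _ fun x => ?_)
    simp only [Pi.add_apply]
    rw [mul_assoc, ← Real.exp_add, neg_add]
  refine ⟨fun h => ?_, key U V hU hC⟩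
  have := key (-U) (V + U) hU.neg (fun x => by simpa using hC x) h
  simpa using this

/-- The Holley–Stroock perturbation principle. -/
lemma Poincare.add_bounded (hV : Continuous V) (hVi : Integrable (fun x => Real.exp (-V x)) D.vol)
    (hU : Continuous U) {C : ℝ} (hC : ∀ x, |U x| ≤ C) (h : Poincare D (gibbs D V)) :
    Poincare D (gibbs D (V + U)) := by
  obtain ⟨R, hR, hP⟩ := h
  have hW : Continuous (V + U) := hV.add hU
  have hWi : Integrable (fun x => Real.exp (-(V + U) x)) D.vol := by
    simpa using (integrable_mul_exp_add_iff (φ := fun _ => 1) hU hC).2 (by simpa using hVi)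
  have hZ := partition_pos hVi
  have hZ' := partition_pos hWi
  have hPr := isProbabilityMeasure_gibbs hW hWi
  have hL : ∀ {ψ}, MemLp ψ 2 (gibbs D (V + U)) → MemLp ψ 2 (gibbs D V) := fun {ψ} hψ => by
    rw [memLp_gibbs_iff hW hWi] at hψ
    rw [memLp_gibbs_iff hV hVi]
    exact ⟨hψ.1, (integrable_mul_exp_add_iff hU hC).1 hψ.2⟩
  -- One factor `e^C` comes from each comparison of weights; the normalisations cancel in each
  -- Poincaré inequality.
  refine ⟨R * Real.exp (-(2 * C)), by positivity, fun φ φ' hφ => ?_⟩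
  set m := mean D V φ
  have hH := memH1Zero_sub_mean hV hVi (hL hφ.memLp) (hL hφ.memLp_deriv) hφ.weakDeriv
  have h1 := hP _ _ hH
  rw [integral_gibbs hV hVi, integral_gibbs hV hVi, ← mul_div_assoc, div_le_div_iff_of_pos_right hZ]
    at h1
  have hsq := ((memLp_gibbs_iff hV hVi).1 hH.memLp).2
  have hsq' := ((memLp_gibbs_iff hV hVi).1 hH.memLp_deriv).2
  have hsq₂ := (integrable_mul_exp_add_iff hU hC).2 hsq
  have hsq₂' := (integrable_mul_exp_add_iff hU hC).2 hsq'
  -- The two measures have different means; centring at the `μ_U`-mean, here `0`, minimises the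
  -- quadratic integral.
  have e1 : ∫ x, φ x ^ 2 ∂(gibbs D (V + U)) ≤ ∫ x, (φ x - m) ^ 2 ∂(gibbs D (V + U)) := by
    have i1 := (memLp_two_iff_integrable_sq hφ.memLp.1).1 hφ.memLp
    have i2 := hφ.memLp.integrable (by norm_num : (1 : ENNReal) ≤ 2)
    have : ∫ x, (φ x - m) ^ 2 ∂(gibbs D (V + U)) =
        ∫ x, (φ x ^ 2 - 2 * m * φ x + m ^ 2) ∂(gibbs D (V + U)) := by
      congr 1; funext x; ring
    have i3 : Integrable (fun x => φ x ^ 2 - 2 * m * φ x) (gibbs D (V + U)) :=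
      i1.sub (i2.const_mul _)
    rw [this, integral_add i3 (integrable_const _), integral_sub i1 (i2.const_mul _), integral_const_mul, hφ.mean_zero]
    simp only [mul_zero, sub_zero, integral_const, probReal_univ, one_smul]
    nlinarith [sq_nonneg m]
  have e2 : ∫ x, (φ x - m) ^ 2 * Real.exp (-(V + U) x) ∂D.vol ≤
      Real.exp C * ∫ x, (φ x - m) ^ 2 * Real.exp (-V x) ∂D.vol := by
    rw [← integral_const_mul]
    refine integral_mono hsq₂ (hsq.const_mul _) fun x => ?_
    simp only [Pi.add_apply]
    rw [neg_add, Real.exp_add, mul_left_comm, mul_comm (Real.exp C), ← mul_assoc]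
    have : Real.exp (-U x) ≤ Real.exp C := Real.exp_le_exp.2 ((neg_le_abs _).trans (hC x))
    calc _ = ((φ x - m) ^ 2 * Real.exp (-V x)) * Real.exp (-U x) := by ring
      _ ≤ ((φ x - m) ^ 2 * Real.exp (-V x)) * Real.exp C := by gcongr
      _ = _ := by ring
  have e3 : ∫ x, φ' x ^ 2 * Real.exp (-V x) ∂D.vol ≤
      Real.exp C * ∫ x, φ' x ^ 2 * Real.exp (-(V + U) x) ∂D.vol := by
    rw [← integral_const_mul]
    refine integral_mono hsq' (hsq₂'.const_mul _) fun x => ?_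
    simp only [Pi.add_apply]
    have : 1 ≤ Real.exp C * Real.exp (-U x) := by
      rw [← Real.exp_add]
      exact Real.one_le_exp (by linarith [le_abs_self (U x), hC x])
    calc φ' x ^ 2 * Real.exp (-V x) = (φ' x ^ 2 * Real.exp (-V x)) * 1 := (mul_one _).symm
      _ ≤ (φ' x ^ 2 * Real.exp (-V x)) * (Real.exp C * Real.exp (-U x)) := by gcongr
      _ = _ := by rw [neg_add, Real.exp_add]; ring
  refine e1.trans ?_
  rw [integral_gibbs hW hWi, integral_gibbs hW hWi, ← mul_div_assoc,
    div_le_div_iff_of_pos_right hZ']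
  calc _ ≤ _ := e2
    _ ≤ Real.exp C * (1 / R * (Real.exp C * ∫ x, φ' x ^ 2 * Real.exp (-(V + U) x) ∂D.vol)) := by
      gcongr
      exact h1.trans (by gcongr)
    _ = _ := by
      rw [show -(2 * C) = -C + -C by ring, Real.exp_add, Real.exp_neg]
      field_simp

/-! ### Test functions are nice biasing potentials -/

lemma locallyLipschitz_drift {W : ℝ → ℝ} (hW : ContDiff ℝ ∞ W) :
    LocallyLipschitz fun x => -deriv W x := by
  have h : ContDiff ℝ ∞ fun x => -deriv W x := (contDiff_infty_iff_deriv.1 hW).2.neg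
  exact (h.of_le (by simp)).locallyLipschitz

/-- Boundedness of `U` transfers the integrability conditions and the Poincaré inequality. For
well-posedness, the drift changes only on a compact set on the line, and is bounded on the torus. -/
lemma memU0_of_smoothCompact (hV : D.Smooth V) (h0 : MemU0 D V f 0) (hU : D.SmoothCompact U) :
    MemU0 D V f U := by
  obtain ⟨hVc, hVp⟩ := Dom.smooth_iff.1 hV
  obtain ⟨C, hC⟩ := hU.bounded
  have hVi : Integrable (fun x => Real.exp (-V x)) D.vol := by simpa using h0.integrable
  have hWi : Integrable (fun x => Real.exp (-(V + U) x)) D.vol := by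
    simpa using (integrable_mul_exp_add_iff (φ := fun _ => 1) hU.continuous hC).2 (by simpa using hVi)
  have hW : Continuous (V + U) := hVc.continuous.add hU.continuous
  refine ⟨hU.smooth, hWi, ?_, ?_, ?_⟩
  · exact Poincare.add_bounded hVc.continuous hVi hU.continuous hC (by simpa using h0.poincare)
  · have h1 := h0.memLp
    simp only [Pi.zero_apply, Real.exp_zero, mul_one, add_zero] at h1
    obtain ⟨hm, hI⟩ := (memLp_gibbs_iff hVc.continuous hVi).1 h1
    rw [memLp_gibbs_iff hW hWi]
    have hUc : Continuous fun x => Real.exp (U x) := Real.continuous_exp.comp hU.continuous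
    refine ⟨hm.mul hUc.aestronglyMeasurable, ?_⟩
    -- The perturbation is by `-U`, because `e^{2U} e^{-(V+U)} = e^{-(V-U)}`.
    refine (integrable_mul_exp_add_iff (φ := fun x => (f x - mean D V f) ^ 2)
      hU.continuous.neg (C := C) (fun x => by simpa using hC x)).2 hI |>.congr (ae_of_all _ fun x => ?_)
    simp only [Pi.add_apply, Pi.neg_apply]
    rw [mul_pow, mul_assoc, ← Real.exp_nat_mul, ← Real.exp_add]
    congr 2
    push_cast
    ring
  · have hVl := locallyLipschitz_drift hVc
    have hWl := locallyLipschitz_drift (hVc.add hU.contDiff)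
    cases D
    · obtain ⟨K, hK⟩ := hU.2.isCompact.isBounded.subset_closedBall 0
      refine StronglyWellPosed.of_eq_off_compact (K := K + 1) (by simpa using h0.wellPosed) hVl hWl
        fun z hz => ?_
      have : deriv U z = 0 := by
        refine image_eq_zero_of_notMem_tsupport fun h => ?_
        have := hK (tsupport_deriv_subset h)
        rw [Metric.mem_closedBall, dist_zero_right, Real.norm_eq_abs] at this
        linarith
      rw [deriv_add (hVc.differentiable (by simp) z) (hU.contDiff.differentiable (by simp) z), this,
        add_zero]
    · have hS : Dom.torus.SmoothCompact (V + U) := Dom.SmoothCompact.add (D := .torus) hV hU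
      obtain ⟨C', hC'⟩ := hS.deriv.bounded
      exact stronglyWellPosed_of_bounded hWl (C := C') fun z => by rw [abs_neg]; exact hC' z

end Gibbs

/-! ### Square integrability from the Poincaré inequality -/

section Integration

variable {μ : Measure ℝ} {a b W : ℝ → ℝ}

lemma sq_integral_mul_le (ha : Integrable (fun x => a x ^ 2) μ) (hb : Integrable (fun x => b x ^ 2) μ)
    (hab : Integrable (fun x => a x * b x) μ) :
    (∫ x, a x * b x ∂μ) ^ 2 ≤ (∫ x, a x ^ 2 ∂μ) * ∫ x, b x ^ 2 ∂μ := by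
  have h : ∀ t : ℝ, 0 ≤ (∫ x, a x ^ 2 ∂μ) * (t * t) + (2 * ∫ x, a x * b x ∂μ) * t +
      ∫ x, b x ^ 2 ∂μ := fun t => by
    have h0 : 0 ≤ ∫ x, (t * a x + b x) ^ 2 ∂μ := integral_nonneg fun x => sq_nonneg _
    have h1 : ∫ x, (t * a x + b x) ^ 2 ∂μ =
        ∫ x, (t * t * a x ^ 2 + 2 * t * (a x * b x) + b x ^ 2) ∂μ := by
      congr 1; funext x; ring
    have i : Integrable (fun x => t * t * a x ^ 2 + 2 * t * (a x * b x)) μ :=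
      (ha.const_mul _).add (hab.const_mul _)
    rw [h1, integral_add i hb, integral_add (ha.const_mul _) (hab.const_mul _), integral_const_mul,
      integral_const_mul] at h0
    linarith
  have := discrim_le_zero h
  rw [discrim] at this
  nlinarith

lemma sq_integral_mul_le_weighted (ha : Integrable (fun x => a x ^ 2 * Real.exp (W x)) μ)
    (hb : Integrable (fun x => b x ^ 2 * Real.exp (-W x)) μ)
    (hab : Integrable (fun x => a x * b x) μ) :
    (∫ x, a x * b x ∂μ) ^ 2 ≤
      (∫ x, a x ^ 2 * Real.exp (W x) ∂μ) * ∫ x, b x ^ 2 * Real.exp (-W x) ∂μ := by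
  have e1 : ∀ x, (a x * Real.exp (W x / 2)) ^ 2 = a x ^ 2 * Real.exp (W x) := fun x => by
    rw [mul_pow, ← Real.exp_nat_mul]; congr 2; push_cast; ring
  have e2 : ∀ x, (b x * Real.exp (-W x / 2)) ^ 2 = b x ^ 2 * Real.exp (-W x) := fun x => by
    rw [mul_pow, ← Real.exp_nat_mul]; congr 2; push_cast; ring
  have e3 : ∀ x, a x * Real.exp (W x / 2) * (b x * Real.exp (-W x / 2)) = a x * b x := fun x => by
    rw [mul_mul_mul_comm, ← Real.exp_add, neg_div, add_neg_cancel, Real.exp_zero, mul_one]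
  have := sq_integral_mul_le (μ := μ) (a := fun x => a x * Real.exp (W x / 2))
    (b := fun x => b x * Real.exp (-W x / 2)) (by simpa only [e1] using ha)
    (by simpa only [e2] using hb) (by simpa only [e3] using hab)
  simpa only [e1, e2, e3] using this

/-- Fatou's lemma, for passing from truncations to the limit. The bound is asked only for `n ≥ 1`,
where a cutoff is already `1` on `[-1, 1]`. -/
lemma integrable_of_integral_le {h : ℕ → ℝ → ℝ} {g : ℝ → ℝ} {C : ℝ} (h0 : ∀ n x, 0 ≤ h n x)
    (hi : ∀ n, Integrable (h n) μ) (hC : ∀ n, 1 ≤ n → ∫ x, h n x ∂μ ≤ C)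
    (hg : ∀ x, Tendsto (fun n => h n x) atTop (𝓝 (g x))) : Integrable g μ := by
  refine integrable_of_tendsto (ae_of_all _ hg) (fun n => (hi n).1) (ne_of_lt ?_)
  refine (liminf_le_of_frequently_le' (x := ENNReal.ofReal C) ?_).trans_lt ENNReal.ofReal_lt_top
  refine ((eventually_ge_atTop 1).mono fun n hn => ?_).frequently
  have : ∫⁻ x, ‖h n x‖ₑ ∂μ = ENNReal.ofReal (∫ x, h n x ∂μ) := by
    rw [ofReal_integral_eq_lintegral_ofReal (hi n) (ae_of_all _ (h0 n))]
    refine lintegral_congr fun x => ?_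
    rw [Real.enorm_eq_ofReal (h0 n x)]
  rw [this]
  exact ENNReal.ofReal_le_ofReal (hC n hn)

lemma abs_primitive_le {u : ℝ → ℝ} (hu : Integrable u) (x : ℝ) :
    |∫ y in (0 : ℝ)..x, u y| ≤ ∫ y, |u y| :=
  (intervalIntegral.norm_integral_le_integral_norm_uIoc).trans
    (setIntegral_le_integral hu.norm (ae_of_all _ fun _ => norm_nonneg _))

end Integration

section Poincare

variable {D : Dom} {W φ φ' G g : ℝ → ℝ}

/-- The Poincaré inequality for classical functions, centred at their mean and freed of the
normalisation, which cancels. -/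
lemma Poincare.exists_bound (hW : Continuous W)
    (hi : Integrable (fun x => Real.exp (-W x)) D.vol) (hP : Poincare D (gibbs D W)) :
    ∃ c, 0 ≤ c ∧ ∀ φ φ' : ℝ → ℝ, (∀ x, HasDerivAt φ (φ' x) x) → Continuous φ' → D.Per φ →
      Integrable (fun x => φ x ^ 2 * Real.exp (-W x)) D.vol →
      Integrable (fun x => φ' x ^ 2 * Real.exp (-W x)) D.vol →
      ∃ m, Integrable (fun x => (φ x - m) ^ 2 * Real.exp (-W x)) D.vol ∧
        ∫ x, (φ x - m) ^ 2 * Real.exp (-W x) ∂D.vol ≤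
        c * ∫ x, φ' x ^ 2 * Real.exp (-W x) ∂D.vol := by
  obtain ⟨R, hR, hP⟩ := hP
  refine ⟨1 / R, by positivity, fun φ φ' hd hc hp h h' => ⟨mean D W φ, ?_⟩⟩
  have hφc : Continuous φ := continuous_iff_continuousAt.2 fun x => (hd x).continuousAt
  have hH := memH1Zero_sub_mean hW hi ((memLp_gibbs_iff hW hi).2 ⟨hφc.aestronglyMeasurable, h⟩)
    ((memLp_gibbs_iff hW hi).2 ⟨hc.aestronglyMeasurable, h'⟩) (isWeakDeriv_of_hasDerivAt hd hc hp)
  have h1 := hP _ _ hH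
  rw [integral_gibbs hW hi, integral_gibbs hW hi, ← mul_div_assoc,
    div_le_div_iff_of_pos_right (partition_pos hi)] at h1
  exact ⟨((memLp_gibbs_iff hW hi).1 hH.memLp).2, h1⟩

lemma integrable_sq_mul_of_bounded (hi : Integrable (fun x => Real.exp (-W x)) D.vol)
    (hφ : Continuous φ) {C : ℝ} (hC : ∀ x, |φ x| ≤ C) :
    Integrable (fun x => φ x ^ 2 * Real.exp (-W x)) D.vol :=
  hi.bdd_mul (c := C ^ 2) (by fun_prop) (ae_of_all _ fun x => by
    rw [Real.norm_eq_abs, abs_pow]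
    have := hC x
    gcongr)

/-- On the line, a vanishing flux with square integrable divergence is square integrable. -/
lemma Poincare.integrable_flux_sq (hW : Continuous W)
    (hi : Integrable (fun x => Real.exp (-W x)) Dom.line.vol)
    (hP : Poincare .line (gibbs .line W)) (hG : ∀ x, HasDerivAt G (g x) x)
    (hgi : Integrable g) (hg0 : ∫ x, g x = 0)
    (hQ : Integrable (fun x => g x ^ 2 * Real.exp (W x)) Dom.line.vol)
    (hbot : Tendsto G atBot (𝓝 0)) (htop : Tendsto G atTop (𝓝 0)) :
    Integrable (fun x => G x ^ 2 * Real.exp (W x)) Dom.line.vol := by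
  obtain ⟨c, hc, hP⟩ := hP.exists_bound hW hi
  obtain ⟨χ, hχ, hχ0, hχ1, hχn⟩ := Dom.exists_cutoff .line
  have hGc : Continuous G := continuous_iff_continuousAt.2 fun x => (hG x).continuousAt
  have hint : ∀ n, Integrable (fun x => G x ^ 2 * Real.exp (W x) * χ n x) Dom.line.vol := fun n =>
    Dom.integrable_mul_test (Continuous.locallyIntegrable (by fun_prop)) (hχ n)
  set Q := ∫ x, g x ^ 2 * Real.exp (W x) ∂Dom.line.vol
  have hQ0 : 0 ≤ Q := integral_nonneg fun x => by positivity
  refine integrable_of_integral_le (C := Q * c) (fun n x => mul_nonneg (by positivity) (hχ0 n x)) hint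
    (fun n _ => ?_) (fun x => ?_)
  · set J := ∫ x, G x ^ 2 * Real.exp (W x) * χ n x ∂Dom.line.vol
    have hJ0 : 0 ≤ J := integral_nonneg fun x => mul_nonneg (by positivity) (hχ0 n x)
    -- Duality: with this `ψ'`, integration by parts gives `∫ g ψ = -J`, and `∫ g = 0` lets `ψ` be
    -- centred. Cauchy–Schwarz and Poincaré give `J² ≤ Q c J`, so `J ≤ Q c` uniformly in `n`.
    set ψ' : ℝ → ℝ := fun x => G x * Real.exp (W x) * χ n x
    have hχc := (hχ n).continuous
    have hψ'c : Continuous ψ' := by fun_prop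
    have hψ'i : Integrable ψ' :=
      Dom.integrable_mul_test (D := .line) (u := fun x => G x * Real.exp (W x))
        (Continuous.locallyIntegrable (by fun_prop)) (hχ n)
    set ψ : ℝ → ℝ := fun x => ∫ y in (0 : ℝ)..x, ψ' y
    have hψ := hasDerivAt_primitive hψ'c
    have hψb := abs_primitive_le hψ'i
    have hψc : Continuous ψ := continuous_iff_continuousAt.2 fun x => (hψ x).continuousAt
    have e : ∀ x, ψ' x ^ 2 * Real.exp (-W x) = G x ^ 2 * Real.exp (W x) * χ n x * χ n x := fun x => by
      have : Real.exp (W x) * Real.exp (-W x) = 1 := by rw [← Real.exp_add]; simp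
      simp only [ψ']
      linear_combination (G x ^ 2 * Real.exp (W x) * χ n x ^ 2) * this
    have hψ'2 : Integrable (fun x => ψ' x ^ 2 * Real.exp (-W x)) Dom.line.vol := by
      simp only [e]
      exact Dom.integrable_mul_test (hint n).locallyIntegrable (hχ n)
    obtain ⟨m, hm, hle⟩ := hP ψ ψ' hψ hψ'c trivial (integrable_sq_mul_of_bounded hi hψc hψb) hψ'2
    have hle2 : ∫ x, ψ' x ^ 2 * Real.exp (-W x) ∂Dom.line.vol ≤ J := by
      refine integral_mono hψ'2 (hint n) fun x => ?_
      simp only [e]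
      exact mul_le_of_le_one_right (mul_nonneg (by positivity) (hχ0 n x)) (hχ1 n x)
    have hψg : Integrable (fun x => ψ x * g x) :=
      hgi.bdd_mul hψc.aestronglyMeasurable (ae_of_all _ hψb)
    have hlim : ∀ {l : Filter ℝ}, Tendsto G l (𝓝 0) → Tendsto (ψ * G) l (𝓝 0) := fun {l} h => by
      have := bdd_le_mul_tendsto_zero' (∫ y, |ψ' y|) (Eventually.of_forall hψb) h
      exact this
    have hψ'G : ∀ x, ψ' x * G x = G x ^ 2 * Real.exp (W x) * χ n x := fun x => by
      simp only [ψ']; ring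
    have hibp := integral_mul_deriv_eq_deriv_mul (fun x _ => hψ x) (fun x _ => hG x) hψg
      (show Integrable (fun x => ψ' x * G x) by simp only [hψ'G]; exact hint n)
      (hlim hbot) (hlim htop)
    simp only [hψ'G, sub_zero, zero_sub] at hibp
    have hgm : Integrable (fun x => g x * (ψ x - m)) := by
      have := hψg.sub (hgi.mul_const m)
      refine this.congr (ae_of_all _ fun x => ?_)
      simp only [Pi.sub_apply]
      ring
    have h2 : ∫ x, g x * (ψ x - m) = -J := by
      rw [show (fun x => g x * (ψ x - m)) = fun x => ψ x * g x - g x * m by funext x; ring,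
        integral_sub hψg (hgi.mul_const m), integral_mul_const, hg0, hibp]
      simp only [zero_mul, sub_zero]
      rfl
    have hcs := sq_integral_mul_le_weighted (μ := volume) (W := W) hQ hm hgm
    rw [h2] at hcs
    have h3 : J * J ≤ Q * c * J := by
      calc J * J = (-J) ^ 2 := by ring
        _ ≤ _ := hcs
        _ ≤ Q * (c * J) := mul_le_mul_of_nonneg_left
          (hle.trans (mul_le_mul_of_nonneg_left hle2 hc)) hQ0
        _ = _ := by ring
    rcases hJ0.eq_or_lt with h | h
    · rw [← h]; positivity
    · exact le_of_mul_le_mul_right h3 h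
  · obtain ⟨N, hN⟩ := exists_nat_ge |x|
    refine tendsto_const_nhds.congr' ?_
    filter_upwards [eventually_ge_atTop N] with n hn
    rw [hχn n x (hN.trans (by exact_mod_cast hn)), mul_one]

/-- Under a Poincaré inequality, functions with square integrable derivative are square
integrable. -/
lemma Poincare.integrable_sq (hW : Continuous W)
    (hi : Integrable (fun x => Real.exp (-W x)) D.vol) (hP : Poincare D (gibbs D W))
    (hφ : ∀ x, HasDerivAt φ (φ' x) x) (hφ' : Continuous φ')
    (h' : Integrable (fun x => φ' x ^ 2 * Real.exp (-W x)) D.vol) :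
    Integrable (fun x => φ x ^ 2 * Real.exp (-W x)) D.vol := by
  have hφc : Continuous φ := continuous_iff_continuousAt.2 fun x => (hφ x).continuousAt
  cases D
  swap
  · exact Dom.integrable_torus (Continuous.locallyIntegrable (by fun_prop))
  obtain ⟨c, hc, hP⟩ := hP.exists_bound hW hi
  obtain ⟨χ, hχ, hχ0, hχ1, hχn⟩ := Dom.exists_cutoff .line
  set Q := ∫ x, φ' x ^ 2 * Real.exp (-W x) ∂Dom.line.vol
  set ψ' : ℕ → ℝ → ℝ := fun n x => φ' x * χ n x
  -- Cutting off the derivative rather than `φ` gives a bounded function equal to `φ` on `[-n, n]`,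
  -- with no term from differentiating the cutoff.
  set ψ : ℕ → ℝ → ℝ := fun n x => φ 0 + ∫ y in (0 : ℝ)..x, ψ' n y
  have hψ'c : ∀ n, Continuous (ψ' n) := fun n => hφ'.mul (hχ n).continuous
  have hψ : ∀ n x, HasDerivAt (ψ n) (ψ' n x) x := fun n x =>
    (hasDerivAt_primitive (hψ'c n) x).const_add _
  have hψc : ∀ n, Continuous (ψ n) := fun n => continuous_iff_continuousAt.2 fun x =>
    (hψ n x).continuousAt
  have hψ2 : ∀ n, Integrable (fun x => ψ n x ^ 2 * Real.exp (-W x)) Dom.line.vol := fun n =>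
    integrable_sq_mul_of_bounded hi (hψc n) fun x => (abs_add_le _ _).trans (add_le_add le_rfl
      (abs_primitive_le (Dom.integrable_mul_test (D := .line) hφ'.locallyIntegrable (hχ n)) x))
  have hψ'le : ∀ n x, ψ' n x ^ 2 * Real.exp (-W x) ≤ φ' x ^ 2 * Real.exp (-W x) := fun n x => by
    refine mul_le_mul_of_nonneg_right ?_ (Real.exp_pos _).le
    simp only [ψ', mul_pow]
    exact mul_le_of_le_one_right (sq_nonneg _) (pow_le_one₀ (hχ0 n x) (hχ1 n x))
  have hψ'2 : ∀ n, Integrable (fun x => ψ' n x ^ 2 * Real.exp (-W x)) Dom.line.vol := fun n =>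
    h'.mono' (Continuous.aestronglyMeasurable (((hψ'c n).pow 2).mul (by fun_prop)))
      (ae_of_all _ fun x => by
        rw [Real.norm_eq_abs, abs_of_nonneg (by positivity)]
        exact hψ'le n x)
  have hψφ : ∀ (n : ℕ) (x : ℝ), |x| ≤ (n : ℝ) → ψ n x = φ x := fun n x hx => by
    have h1 : ∫ y in (0 : ℝ)..x, ψ' n y = ∫ y in (0 : ℝ)..x, φ' y := by
      refine intervalIntegral.integral_congr fun y hy => ?_
      have hyx : |y| ≤ n := by
        rw [abs_le] at hx ⊢
        rcases mem_uIcc.1 hy with h | h <;> constructor <;> linarith [n.cast_nonneg (α := ℝ)]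
      simp only [ψ', hχn n y hyx, mul_one]
    simp only [ψ]
    rw [h1, intervalIntegral.integral_eq_sub_of_hasDerivAt (fun y _ => hφ y)
      (hφ'.intervalIntegrable _ _)]
    ring
  choose m hm hmle using fun n => hP (ψ n) (ψ' n) (hψ n) (hψ'c n) trivial (hψ2 n) (hψ'2 n)
  have hmle' : ∀ n, ∫ x, (ψ n x - m n) ^ 2 * Real.exp (-W x) ∂Dom.line.vol ≤ c * Q := fun n =>
    (hmle n).trans (mul_le_mul_of_nonneg_left (integral_mono (hψ'2 n) h' (hψ'le n)) hc)
  -- the means are bounded, because `ψ n = φ` on `[-1, 1]` for `n ≥ 1`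
  obtain ⟨B, hB⟩ := (isCompact_Icc (a := (-1 : ℝ)) (b := 1)).exists_bound_of_continuousOn
    hφc.continuousOn
  set κ := ∫ x in Icc (-1 : ℝ) 1, Real.exp (-W x)
  have hi' : IntegrableOn (fun x => Real.exp (-W x)) (Icc (-1 : ℝ) 1) := Integrable.integrableOn hi
  have hκ : 0 < κ := by
    have : NeZero (volume.restrict (Icc (-1 : ℝ) 1)) := ⟨fun h => by
      have := congrArg (fun μ => μ univ) h
      simp only [Measure.restrict_apply_univ, Real.volume_Icc, Measure.coe_zero, Pi.zero_apply,
        ENNReal.ofReal_eq_zero] at this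
      linarith⟩
    exact integral_exp_pos hi'
  have hmb : ∀ n, 1 ≤ n → m n ^ 2 ≤ (2 * (c * Q) + 2 * B ^ 2 * κ) / κ := fun n hn => by
    rw [le_div_iff₀ hκ, ← integral_const_mul]
    have hm' : IntegrableOn (fun x => (ψ n x - m n) ^ 2 * Real.exp (-W x)) (Icc (-1 : ℝ) 1) :=
      Integrable.integrableOn (hm n)
    have h1 : ∫ x in Icc (-1 : ℝ) 1, (ψ n x - m n) ^ 2 * Real.exp (-W x) ≤ c * Q :=
      (setIntegral_le_integral (hm n) (ae_of_all _ fun x => by positivity)).trans (hmle' n)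
    calc _ ≤ ∫ x in Icc (-1 : ℝ) 1, (2 * ((ψ n x - m n) ^ 2 * Real.exp (-W x)) +
          2 * B ^ 2 * Real.exp (-W x)) := by
          refine setIntegral_mono_on (hi'.const_mul _) ((hm'.const_mul _).add (hi'.const_mul _))
            measurableSet_Icc fun x hx => ?_
          have hx1 : |x| ≤ (n : ℝ) := (abs_le.2 hx).trans (by exact_mod_cast hn)
          have hxB := hB x hx
          rw [← hψφ n x hx1, Real.norm_eq_abs] at hxB
          have hsq : ψ n x ^ 2 ≤ B ^ 2 := sq_le_sq.2 (hxB.trans (le_abs_self B))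
          rw [← mul_assoc, ← add_mul]
          gcongr
          nlinarith [sq_nonneg (2 * ψ n x - m n)]
      _ = 2 * (∫ x in Icc (-1 : ℝ) 1, (ψ n x - m n) ^ 2 * Real.exp (-W x)) + 2 * B ^ 2 * κ := by
          rw [integral_add (hm'.const_mul _) (hi'.const_mul _), integral_const_mul,
            integral_const_mul]
      _ ≤ _ := by gcongr
  set S := (2 * (c * Q) + 2 * B ^ 2 * κ) / κ
  refine integrable_of_integral_le (C := 2 * (c * Q) + 2 * S * partition .line W)
    (fun n x => by positivity) hψ2 (fun n hn => ?_) (fun x => ?_)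
  · calc _ ≤ ∫ x, (2 * ((ψ n x - m n) ^ 2 * Real.exp (-W x)) + 2 * S * Real.exp (-W x))
          ∂Dom.line.vol := by
          refine integral_mono (hψ2 n) (((hm n).const_mul _).add (hi.const_mul _)) fun x => ?_
          simp only
          rw [← mul_assoc, ← add_mul]
          gcongr
          nlinarith [sq_nonneg (ψ n x - 2 * m n), hmb n hn]
      _ = 2 * (∫ x, (ψ n x - m n) ^ 2 * Real.exp (-W x) ∂Dom.line.vol) +
          2 * S * partition .line W := by
          rw [integral_add ((hm n).const_mul _) (hi.const_mul _), integral_const_mul,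
            integral_const_mul, partition]
      _ ≤ _ := by gcongr; exact hmle' n
  · obtain ⟨N, hN⟩ := exists_nat_ge |x|
    refine tendsto_const_nhds.congr' ?_
    filter_upwards [eventually_ge_atTop N] with n hn
    rw [hψφ n x (hN.trans (by exact_mod_cast hn))]

end Poincare

/-! ### The Poisson equation -/

/-- The standing assumptions: smooth potential and observable, nice biasing potential. -/
structure Admissible (D : Dom) (V f U : ℝ → ℝ) : Prop where
  smoothV : D.Smooth V
  smoothf : D.Smooth f
  intV : Integrable (fun x => Real.exp (-V x)) D.vol
  intf : Integrable f (gibbs D V)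
  memU0 : MemU0 D V f U

/-- The density `(f - I) e^{-V}`, whose primitive is `primF`. -/
noncomputable def source (D : Dom) (V f : ℝ → ℝ) (x : ℝ) : ℝ :=
  (f x - mean D V f) * Real.exp (-V x)

/-- The constant `A_U` such that `φ_U' = -(F - A_U) e^{V + U}`. -/
noncomputable def fluxConst (D : Dom) (V f U : ℝ → ℝ) : ℝ :=
  match D with
  | .line => Astar .line V f
  | .torus => (∫ x, primF .torus V f x * Real.exp ((V + U) x) ∂Dom.torus.vol) /
      ∫ x, Real.exp ((V + U) x) ∂Dom.torus.vol

/-- The flux `F - A_U = -φ_U' e^{-(V + U)}`. -/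
noncomputable def flux (D : Dom) (V f U : ℝ → ℝ) (x : ℝ) : ℝ := primF D V f x - fluxConst D V f U

/-- A test function with vanishing integral is the derivative of a test function. -/
lemma exists_test_primitive {D : Dom} {ζ : ℝ → ℝ} (hζ : D.SmoothCompact ζ)
    (h0 : ∫ x, ζ x ∂D.vol = 0) : ∃ η, D.SmoothCompact η ∧ ∀ x, deriv η x = ζ x := by
  have hd := hasDerivAt_primitive hζ.continuous
  have hs := contDiff_primitive hζ.contDiff
  cases D
  swap
  · exact ⟨_, ⟨hs, Dom.Per.primitive (D := .torus) hζ.continuous hζ.2 fun _ => h0⟩,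
      fun x => (hd x).deriv⟩
  obtain ⟨R, hR⟩ := hζ.2.isCompact.isBounded.subset_closedBall 0
  have hz : ∀ x, R < |x| → ζ x = 0 := fun x hx => image_eq_zero_of_notMem_tsupport fun h => by
    have := hR h
    rw [Metric.mem_closedBall, dist_zero_right, Real.norm_eq_abs] at this
    linarith
  have hi : ∀ a b, IntervalIntegrable ζ volume a b := hζ.continuous.intervalIntegrable
  set K := |R| + 1
  have hKR : R < K := by linarith [le_abs_self R]
  have hK0 : 0 < K := by positivity
  -- This primitive is normalised to vanish left of the support; it vanishes right of it because `∫
  -- ζ = 0`.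
  refine ⟨fun x => (∫ y in (0 : ℝ)..x, ζ y) - ∫ y in (0 : ℝ)..(-K), ζ y,
    ⟨hs.sub contDiff_const, ?_⟩, fun x => ((hd x).sub_const _).deriv⟩
  have hzero : ∀ x, K < |x| → (∫ y in (0 : ℝ)..x, ζ y) - (∫ y in (0 : ℝ)..(-K), ζ y) = 0 := by
    intro x hx
    rw [intervalIntegral.integral_interval_sub_left (hi _ _) (hi _ _)]
    rcases lt_abs.1 hx with h | h
    · rw [intervalIntegral.integral_eq_integral_of_support_subset]
      · exact h0
      · intro y hy
        by_contra hyn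
        refine hy (hz y ?_)
        rw [mem_Ioc, not_and_or, not_lt, not_le] at hyn
        rcases hyn with h' | h'
        · exact hKR.trans_le (le_abs.2 (Or.inr (by linarith)))
        · exact hKR.trans (lt_abs.2 (Or.inl (by linarith)))
    · rw [intervalIntegral.integral_congr (g := fun _ => 0) fun y hy => hz y ?_]
      · simp
      · rw [uIcc_of_ge (by linarith)] at hy
        exact hKR.trans_le (le_abs.2 (Or.inr (by linarith [hy.2])))
  refine HasCompactSupport.of_support_subset_isCompact (isCompact_closedBall (0 : ℝ) K) fun x hx => ?_
  rw [Metric.mem_closedBall, dist_zero_right, Real.norm_eq_abs]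
  by_contra! h
  exact hx (hzero x h)

namespace Admissible

variable {D : Dom} {V f U : ℝ → ℝ}

section

variable (h : Admissible D V f U)
include h

/-! ### The source `(f - I) e^{-V}` and its primitives -/

lemma contDiffV : ContDiff ℝ ∞ V := (Dom.smooth_iff.1 h.smoothV).1

lemma smoothW : D.Smooth (V + U) := by
  have h1 := Dom.smooth_iff.1 h.smoothV
  have h2 := Dom.smooth_iff.1 h.memU0.smooth
  exact Dom.smooth_iff.2 ⟨h1.1.add h2.1, h1.2.comp₂ (· + ·) h2.2⟩

lemma contW : Continuous (V + U) := (Dom.smooth_iff.1 h.smoothW).1.continuous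

lemma intW : Integrable (fun x => Real.exp (-(V + U) x)) D.vol := h.memU0.integrable

lemma smooth_exp (c : ℝ) : D.Smooth fun x => Real.exp (c * (V + U) x) := by
  obtain ⟨h1, h2⟩ := Dom.smooth_iff.1 h.smoothW
  exact Dom.smooth_iff.2 ⟨(contDiff_const.mul h1).exp, h2.comp fun y => Real.exp (c * y)⟩

lemma contDiff_source : ContDiff ℝ ∞ (source D V f) :=
  ((Dom.smooth_iff.1 h.smoothf).1.sub contDiff_const).mul h.contDiffV.neg.exp

lemma per_source : D.Per (source D V f) :=
  (Dom.smooth_iff.1 h.smoothf).2.comp₂ (fun a b => (a - mean D V f) * Real.exp (-b))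
    (Dom.smooth_iff.1 h.smoothV).2

lemma integrable_source : Integrable (source D V f) D.vol := by
  have := isProbabilityMeasure_gibbs h.contDiffV.continuous h.intV
  exact (integrable_gibbs_iff h.contDiffV.continuous h.intV).1 (h.intf.sub (integrable_const _))

lemma integral_source : ∫ x, source D V f x ∂D.vol = 0 := by
  have := isProbabilityMeasure_gibbs h.contDiffV.continuous h.intV
  have h1 := integral_gibbs h.contDiffV.continuous h.intV fun x => f x - mean D V f
  rw [integral_sub h.intf (integrable_const _), integral_const, probReal_univ, one_smul, mean,
    sub_self, eq_comm, div_eq_zero_iff] at h1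
  exact h1.resolve_right (partition_pos h.intV).ne'

/-- This is condition (iii) rewritten, since `e^{2U} e^{-(V+U)} = e^{-2V} e^{V+U}`. -/
lemma integrable_source_sq :
    Integrable (fun x => source D V f x ^ 2 * Real.exp ((V + U) x)) D.vol := by
  refine ((memLp_gibbs_iff h.contW h.intW).1 h.memU0.memLp).2.congr (ae_of_all _ fun x => ?_)
  simp only [source, Pi.add_apply]
  rw [mul_pow, mul_pow, mul_assoc, mul_assoc, ← Real.exp_nat_mul, ← Real.exp_nat_mul, ← Real.exp_add,
    ← Real.exp_add]
  congr 2
  push_cast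
  ring

lemma hasDerivAt_primF (x : ℝ) : HasDerivAt (primF D V f) (source D V f x) x :=
  hasDerivAt_primitive h.contDiff_source.continuous x

lemma hasDerivAt_flux (x : ℝ) : HasDerivAt (flux D V f U) (source D V f x) x :=
  (h.hasDerivAt_primF x).sub_const _

lemma contDiff_primF : ContDiff ℝ ∞ (primF D V f) := contDiff_primitive h.contDiff_source

lemma per_primF : D.Per (primF D V f) :=
  h.per_source.primitive h.contDiff_source.continuous fun _ => h.integral_source

lemma continuous_flux : Continuous (flux D V f U) :=
  h.contDiff_primF.continuous.sub continuous_const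

lemma per_flux : D.Per (flux D V f U) := h.per_primF.comp fun a => a - fluxConst D V f U

/-- On the line, `A*` makes `F - A*` vanish at `-∞`, hence also at `+∞` because the source has
integral `0`; the duality estimate then applies. On the torus continuity suffices. -/
lemma integrable_flux_sq :
    Integrable (fun x => flux D V f U x ^ 2 * Real.exp ((V + U) x)) D.vol := by
  have hc := h.continuous_flux
  have hW := h.contW
  cases D
  swap
  · exact Dom.integrable_torus (Continuous.locallyIntegrable (by fun_prop))
  have hi : Integrable (source .line V f) := h.integrable_source
  have h0 : (∫ x in Iic 0, source .line V f x) + ∫ x in Ioi 0, source .line V f x = 0 :=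
    (intervalIntegral.integral_Iic_add_Ioi hi.integrableOn hi.integrableOn).trans h.integral_source
  have hA : fluxConst .line V f U = -∫ x in Iic 0, source .line V f x := rfl
  refine Poincare.integrable_flux_sq hW h.intW h.memU0.poincare h.hasDerivAt_flux hi
    h.integral_source h.integrable_source_sq ?_ ?_
  · have h1 := intervalIntegral_tendsto_integral_Iic 0 hi.integrableOn tendsto_id
    have h2 := h1.neg.sub_const (fluxConst .line V f U)
    rw [hA, sub_self] at h2
    refine h2.congr fun x => ?_
    rw [← intervalIntegral.integral_symm]
    rfl
  · have h1 := intervalIntegral_tendsto_integral_Ioi 0 hi.integrableOn tendsto_id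
    have h2 := h1.sub_const (fluxConst .line V f U)
    rw [hA, sub_neg_eq_add, add_comm, h0] at h2
    exact h2

/-- `A_U` is the weighted mean of `F`; this is exactly what makes the primitive of `φ_U'` periodic.
-/
lemma integral_flux_exp (hD : D = .torus) :
    ∫ x, flux D V f U x * Real.exp ((V + U) x) ∂D.vol = 0 := by
  subst hD
  have hW := h.contW
  have hF := h.contDiff_primF.continuous
  have i1 : Integrable (fun x => primF .torus V f x * Real.exp ((V + U) x)) Dom.torus.vol :=
    Dom.integrable_torus (Continuous.locallyIntegrable (by fun_prop))
  have i2 : Integrable (fun x => Real.exp ((V + U) x)) Dom.torus.vol :=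
    Dom.integrable_torus (Continuous.locallyIntegrable (by fun_prop))
  simp only [flux, sub_mul]
  rw [integral_sub i1 (i2.const_mul _), integral_const_mul, fluxConst,
    div_mul_cancel₀ _ (integral_exp_pos i2).ne', sub_self]

/-! ### Uniqueness for the Poisson equation -/

/-- The Poisson equation tested against the primitive of a mean zero function. -/
lemma _root_.BiasedLangevin.IsPoissonSolution.integral_deriv_mul {φ φ' ζ η : ℝ → ℝ}
    (hφ : IsPoissonSolution D V f U φ φ') (hζ : D.SmoothCompact ζ) (hη : D.SmoothCompact η)
    (hd : ∀ x, deriv η x = Real.exp ((V + U) x) * ζ x) :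
    ∫ x, φ' x * ζ x ∂D.vol = ∫ x, source D V f x * η x ∂D.vol := by
  have h1 := hφ.equation η hη
  rw [integral_gibbs h.contW h.intW, integral_gibbs h.contW h.intW,
    div_left_inj' (partition_pos h.intW).ne'] at h1
  have hWd : ∀ x, HasDerivAt (V + U) (deriv (V + U) x) x := fun x =>
    ((Dom.smooth_iff.1 h.smoothW).1.differentiable (by simp) x).hasDerivAt
  have hζd : ∀ x, HasDerivAt ζ (deriv ζ x) x := fun x =>
    (hζ.contDiff.differentiable (by simp) x).hasDerivAt
  have h2 : ∀ x, φ x * -generator (V + U) η x * Real.exp (-(V + U) x) = -(φ x * deriv ζ x) := by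
    intro x
    have hdd : deriv (deriv η) x =
        Real.exp ((V + U) x) * deriv (V + U) x * ζ x + Real.exp ((V + U) x) * deriv ζ x := by
      rw [show deriv η = fun x => Real.exp ((V + U) x) * ζ x from funext hd]
      exact ((hWd x).exp.mul (hζd x)).deriv
    have he : Real.exp ((V + U) x) * Real.exp (-(V + U) x) = 1 := by rw [← Real.exp_add]; simp
    rw [generator, hdd, hd]
    linear_combination (-(φ x * deriv ζ x)) * he
  have h3 : ∀ x, (f x - mean D V f) * Real.exp (U x) * η x * Real.exp (-(V + U) x) =
      source D V f x * η x := by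
    intro x
    rw [source, Pi.add_apply, neg_add, Real.exp_add, Real.exp_neg (U x)]
    field_simp
  simp only [h2, h3, integral_neg] at h1
  rw [← h1, hφ.memH1Zero.weakDeriv ζ hζ, neg_neg]

/-- A du Bois-Reymond argument: the difference of derivatives annihilates every `ζ` with `∫ e^{V+U}
ζ = 0`, so it equals `c e^{V+U}`. Then `c = 0`, by square integrability on the line and by
periodicity on the torus. -/
lemma poisson_deriv_unique {φ φ' ψ ψ' : ℝ → ℝ} (hφ : IsPoissonSolution D V f U φ φ')
    (hψ : IsPoissonSolution D V f U ψ ψ') : ψ' =ᵐ[D.vol] φ' := by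
  have hW := h.contW
  have hφ' := locallyIntegrable_of_memLp_gibbs hW h.intW hφ.memH1Zero.memLp_deriv
  have hψ' := locallyIntegrable_of_memLp_gibbs hW h.intW hψ.memH1Zero.memLp_deriv
  set w : ℝ → ℝ := fun x => ψ' x - φ' x
  have hw : LocallyIntegrable w D.vol := hψ'.sub hφ'
  have hE : Continuous fun x => Real.exp ((V + U) x) := by fun_prop
  have hEl : LocallyIntegrable (fun x => Real.exp ((V + U) x)) D.vol := hE.locallyIntegrable
  have hEs : D.Smooth fun x => Real.exp ((V + U) x) := by simpa using h.smooth_exp 1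
  have horth : ∀ ζ, D.SmoothCompact ζ → ∫ x, Real.exp ((V + U) x) * ζ x ∂D.vol = 0 →
      ∫ x, w x * ζ x ∂D.vol = 0 := by
    intro ζ hζ h0
    obtain ⟨η, hη, hd⟩ := exists_test_primitive (hζ.mul_left hEs) h0
    simp only [w, sub_mul]
    rw [integral_sub (Dom.integrable_mul_test hψ' hζ) (Dom.integrable_mul_test hφ' hζ),
      hφ.integral_deriv_mul h hζ hη hd, hψ.integral_deriv_mul h hζ hη hd, sub_self]
  -- a test function with `∫ e^{V+U} ζ₀ = 1`
  obtain ⟨ζ₀, hζ₀, hζ₀1⟩ : ∃ ζ₀, D.SmoothCompact ζ₀ ∧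
      ∫ x, Real.exp ((V + U) x) * ζ₀ x ∂D.vol = 1 := by
    by_contra! hne
    have hz : ∀ ζ, D.SmoothCompact ζ → ∫ x, Real.exp ((V + U) x) * ζ x ∂D.vol = 0 := by
      intro ζ hζ
      by_contra h0
      refine hne _ (hζ.mul_left (Dom.Smooth.const (∫ x, Real.exp ((V + U) x) * ζ x ∂D.vol)⁻¹)) ?_
      simp only [mul_left_comm (Real.exp _)]
      rw [integral_const_mul, inv_mul_cancel₀ h0]
    obtain ⟨x, hx⟩ := (Dom.ae_eq_zero_of_integral_test hEl hz).exists
    exact (Real.exp_pos _).ne' hx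
  set c := ∫ x, w x * ζ₀ x ∂D.vol
  have hwc : ∀ᵐ x ∂D.vol, w x - c * Real.exp ((V + U) x) = 0 := by
    refine Dom.ae_eq_zero_of_integral_test (hw.sub (hEl.smul c)) fun ζ hζ => ?_
    set a := ∫ x, Real.exp ((V + U) x) * ζ x ∂D.vol
    -- Subtracting `a ζ₀` puts an arbitrary test function in the class treated by `horth`.
    have hζa : D.SmoothCompact fun x => ζ x + -a * ζ₀ x :=
      hζ.add (hζ₀.mul_left (Dom.Smooth.const (-a)))
    have i1 := Dom.integrable_mul_test hw hζ
    have i2 := Dom.integrable_mul_test hw hζ₀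
    have i3 := Dom.integrable_mul_test hEl hζ
    have i4 := Dom.integrable_mul_test hEl hζ₀
    have h1 := horth _ hζa (by
      simp only [mul_add, mul_left_comm _ (-a)]
      rw [integral_add i3 (i4.const_mul _), integral_const_mul, hζ₀1]
      ring)
    simp only [mul_add, mul_left_comm _ (-a)] at h1
    rw [integral_add i1 (i2.const_mul _), integral_const_mul] at h1
    simp only [sub_mul, mul_assoc]
    rw [integral_sub i1 (i3.const_mul _), integral_const_mul]
    linarith
  have hc : c = 0 := by
    cases D
    · by_contra hc
      have hw2 := ((memLp_gibbs_iff hW h.intW).1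
        (hψ.memH1Zero.memLp_deriv.sub hφ.memH1Zero.memLp_deriv)).2
      have hE1 : Integrable (fun x => c ^ 2 * Real.exp ((V + U) x)) Dom.line.vol := by
        refine hw2.congr ?_
        filter_upwards [hwc] with x hx
        have he : Real.exp ((V + U) x) * Real.exp (-(V + U) x) = 1 := by rw [← Real.exp_add]; simp
        have hx' : ψ' x - φ' x = c * Real.exp ((V + U) x) := by simpa [w, sub_eq_zero] using hx
        simp only [Pi.sub_apply]
        rw [hx']
        linear_combination (c ^ 2 * Real.exp ((V + U) x)) * he
      have hE2 := (integrable_const_mul_iff (isUnit_iff_ne_zero.2 (pow_ne_zero 2 hc)) _).1 hE1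
      -- If `e^{V+U}` and `e^{-(V+U)}` were both integrable, so would be `1`, which their sum
      -- dominates.
      have h1 : Integrable (fun _ : ℝ => (1 : ℝ)) volume := by
        refine (hE2.add h.intW).mono' (by fun_prop) (ae_of_all _ fun x => ?_)
        simp only [Pi.add_apply, norm_one]
        have h1 := Real.add_one_le_exp (V x + U x)
        have h2 := Real.add_one_le_exp (-(V x + U x))
        linarith
      have h2 := (integrable_const_iff_isFiniteMeasure one_ne_zero).1 h1
      exact (measure_lt_top volume (univ : Set ℝ)).ne Real.volume_univ
    -- Constants are test functions on the torus, so weak derivatives integrate to `0`, while `∫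
    -- e^{V+U} > 0`.
    · have hone : Dom.torus.SmoothCompact fun _ => 1 := Dom.Smooth.const (D := .torus) 1
      have h1 := hψ.memH1Zero.weakDeriv _ hone
      have h2 := hφ.memH1Zero.weakDeriv _ hone
      simp only [deriv_const, mul_zero, integral_zero, mul_one, zero_eq_neg] at h1 h2
      have h3 : ∫ x, w x ∂Dom.torus.vol = 0 := by
        simp only [w]
        rw [integral_sub (Dom.integrable_torus hψ') (Dom.integrable_torus hφ'), h1, h2, sub_zero]
      have h4 : ∫ x, w x ∂Dom.torus.vol = c * ∫ x, Real.exp ((V + U) x) ∂Dom.torus.vol := by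
        rw [← integral_const_mul]
        refine integral_congr_ae ?_
        filter_upwards [hwc] with x hx
        linarith
      rw [h3, eq_comm, mul_eq_zero] at h4
      exact h4.resolve_right (integral_exp_pos (Dom.integrable_torus hEl)).ne'
  filter_upwards [hwc] with x hx
  simp only [hc, zero_mul, sub_zero, w] at hx
  linarith

/-- The difference has mean zero and vanishing derivative, so the Poincaré inequality kills it. -/
lemma poisson_unique {φ φ' ψ ψ' : ℝ → ℝ} (hφ : IsPoissonSolution D V f U φ φ')
    (hψ : IsPoissonSolution D V f U ψ ψ') : ψ =ᵐ[D.vol] φ := by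
  have hW := h.contW
  have := isProbabilityMeasure_gibbs hW h.intW
  obtain ⟨R, hR, hP⟩ := h.memU0.poincare
  have m1 := hφ.memH1Zero
  have m2 := hψ.memH1Zero
  have l1 := locallyIntegrable_of_memLp_gibbs hW h.intW m1.memLp
  have l2 := locallyIntegrable_of_memLp_gibbs hW h.intW m2.memLp
  have l1' := locallyIntegrable_of_memLp_gibbs hW h.intW m1.memLp_deriv
  have l2' := locallyIntegrable_of_memLp_gibbs hW h.intW m2.memLp_deriv
  have hm : MemH1Zero D (gibbs D (V + U)) (fun x => ψ x - φ x) fun x => ψ' x - φ' x := by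
    refine ⟨m2.memLp.sub m1.memLp, ?_, m2.memLp_deriv.sub m1.memLp_deriv, fun η hη => ?_⟩
    · rw [integral_sub (m2.memLp.integrable (by norm_num)) (m1.memLp.integrable (by norm_num)),
        m1.mean_zero, m2.mean_zero, sub_zero]
    · simp only [sub_mul]
      rw [integral_sub (Dom.integrable_mul_test l2 hη.deriv) (Dom.integrable_mul_test l1 hη.deriv),
        integral_sub (Dom.integrable_mul_test l2' hη) (Dom.integrable_mul_test l1' hη),
        m1.weakDeriv η hη, m2.weakDeriv η hη]
      ring
  have hd : ∀ᵐ x ∂gibbs D (V + U), (ψ' x - φ' x) ^ 2 = 0 := by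
    rw [ae_gibbs hW h.intW]
    filter_upwards [h.poisson_deriv_unique hφ hψ] with x hx
    simp [hx]
  have h1 := hP _ _ hm
  rw [integral_eq_zero_of_ae hd, mul_zero] at h1
  have h2 := (integral_eq_zero_iff_of_nonneg (fun x => sq_nonneg _)
    ((memLp_two_iff_integrable_sq hm.memLp.1).1 hm.memLp)).1
    (le_antisymm h1 (integral_nonneg fun x => sq_nonneg _))
  rw [EventuallyEq, ae_gibbs hW h.intW] at h2
  filter_upwards [h2] with x hx
  simpa [sub_eq_zero] using hx

/-! ### Existence, and the explicit asymptotic variance -/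

/-- The derivative of the solution is `-(F - A_U) e^{V + U}`. -/
lemma exists_isPoissonSolution :
    ∃ φ, IsPoissonSolution D V f U φ fun x => -(flux D V f U x * Real.exp ((V + U) x)) := by
  have hW := h.contW
  have hG := h.continuous_flux
  set φ' : ℝ → ℝ := fun x => -(flux D V f U x * Real.exp ((V + U) x))
  have hφ'c : Continuous φ' := by fun_prop
  have hper' : D.Per φ' := h.per_flux.comp₂ (fun a b => -(a * Real.exp b)) (Dom.smooth_iff.1 h.smoothW).2
  set Φ : ℝ → ℝ := fun x => ∫ y in (0 : ℝ)..x, φ' y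
  have hΦ := hasDerivAt_primitive hφ'c
  have hΦc : Continuous Φ := continuous_iff_continuousAt.2 fun x => (hΦ x).continuousAt
  have hper : D.Per Φ := hper'.primitive hφ'c fun hD => by
    simp only [φ', integral_neg, h.integral_flux_exp hD, neg_zero]
  have hφ'2 : Integrable (fun x => φ' x ^ 2 * Real.exp (-(V + U) x)) D.vol := by
    refine h.integrable_flux_sq.congr (ae_of_all _ fun x => ?_)
    have he : Real.exp ((V + U) x) * Real.exp (-(V + U) x) = 1 := by rw [← Real.exp_add]; simp
    simp only [φ']
    linear_combination (-(flux D V f U x ^ 2 * Real.exp ((V + U) x))) * he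
  have hΦ2 := h.memU0.poincare.integrable_sq hW h.intW hΦ hφ'c hφ'2
  have hH := memH1Zero_sub_mean hW h.intW
    ((memLp_gibbs_iff hW h.intW).2 ⟨hΦc.aestronglyMeasurable, hΦ2⟩)
    ((memLp_gibbs_iff hW h.intW).2 ⟨hφ'c.aestronglyMeasurable, hφ'2⟩)
    (isWeakDeriv_of_hasDerivAt hΦ hφ'c hper)
  refine ⟨_, hH, fun η hη => ?_⟩
  rw [integral_gibbs hW h.intW, integral_gibbs hW h.intW]
  congr 1
  have hWd : ∀ x, HasDerivAt (V + U) (deriv (V + U) x) x := fun x =>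
    ((Dom.smooth_iff.1 h.smoothW).1.differentiable (by simp) x).hasDerivAt
  have hηd : ∀ x, HasDerivAt (deriv η) (deriv (deriv η) x) x := fun x =>
    (hη.deriv.contDiff.differentiable (by simp) x).hasDerivAt
  -- Testing the weak derivative against `e^{-(V+U)} η'` gives the Poisson equation, since
  -- `e^{-(V+U)} 𝓛_U η = (e^{-(V+U)} η')'`.
  have hζ : D.SmoothCompact fun x => Real.exp (-(V + U) x) * deriv η x := by
    have := hη.deriv.mul_left (h.smooth_exp (-1))
    simpa using this
  have h1 := hH.weakDeriv _ hζ
  have h2 := Dom.integral_mul_deriv_test h.hasDerivAt_flux h.contDiff_source.continuous h.per_flux hη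
  have e1 : ∀ x, (Φ x - mean D (V + U) Φ) * -generator (V + U) η x * Real.exp (-(V + U) x) =
      -((Φ x - mean D (V + U) Φ) * deriv (fun x => Real.exp (-(V + U) x) * deriv η x) x) := by
    intro x
    have hd : HasDerivAt (fun x => Real.exp (-(V + U) x) * deriv η x)
        (Real.exp (-(V + U) x) * -deriv (V + U) x * deriv η x +
          Real.exp (-(V + U) x) * deriv (deriv η) x) x := (hWd x).neg.exp.mul (hηd x)
    rw [hd.deriv, generator]
    ring
  have e2 : ∀ x, (f x - mean D V f) * Real.exp (U x) * η x * Real.exp (-(V + U) x) =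
      source D V f x * η x := by
    intro x
    rw [source, Pi.add_apply, neg_add, Real.exp_add, Real.exp_neg (U x)]
    field_simp
  have e3 : ∀ x, φ' x * (Real.exp (-(V + U) x) * deriv η x) = -(flux D V f U x * deriv η x) := by
    intro x
    have he : Real.exp ((V + U) x) * Real.exp (-(V + U) x) = 1 := by rw [← Real.exp_add]; simp
    simp only [φ']
    linear_combination (-(flux D V f U x * deriv η x)) * he
  simp only [e1, e2, integral_neg]
  simp only [e3, integral_neg, neg_neg] at h1
  rw [h1, h2, neg_neg]

/-- By uniqueness the chosen solution has the explicit derivative almost everywhere. One factor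
`Z[U]` cancels the normalisation of `μ_U`. -/
lemma asymVar_eq : asymVar D V f U = 2 / partition D V ^ 2 *
    (partition D (V + U) * ∫ x, flux D V f U x ^ 2 * Real.exp ((V + U) x) ∂D.vol) := by
  have hW := h.contW
  obtain ⟨φ, hφ⟩ := h.exists_isPoissonSolution
  have hex : ∃ p : (ℝ → ℝ) × (ℝ → ℝ), IsPoissonSolution D V f U p.1 p.2 := ⟨(φ, _), hφ⟩
  rw [asymVar, dif_pos hex, integral_gibbs hW h.intW]
  have hZ := partition_pos h.intW
  have e : ∫ x, |hex.choose.2 x| ^ 2 * Real.exp (-(V + U) x) ∂D.vol =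
      ∫ x, flux D V f U x ^ 2 * Real.exp ((V + U) x) ∂D.vol := by
    refine integral_congr_ae ?_
    filter_upwards [h.poisson_deriv_unique hφ hex.choose_spec] with x hx
    have he : Real.exp ((V + U) x) * Real.exp (-(V + U) x) = 1 := by rw [← Real.exp_add]; simp
    rw [hx, sq_abs]
    linear_combination (flux D V f U x ^ 2 * Real.exp ((V + U) x)) * he
  rw [e]
  field_simp

end

end Admissible

/-! ### The median minimises the `L¹` distance -/

lemma measurable_real_sign : Measurable Real.sign := by
  unfold Real.sign
  exact Measurable.ite measurableSet_Iio measurable_const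
    (Measurable.ite measurableSet_Ioi measurable_const measurable_const)

/-- The subgradient inequality for the absolute value at `y - B`; the value `0` of the sign at `0`
is an admissible slope. -/
lemma abs_sub_ge_sign (y A B : ℝ) : |y - B| + (B - A) * Real.sign (y - B) ≤ |y - A| := by
  rcases lt_trichotomy (y - B) 0 with h | h | h
  · rw [Real.sign_of_neg h, abs_of_neg h]
    linarith [neg_abs_le (y - A)]
  · rw [h]; simp
  · rw [Real.sign_of_pos h, abs_of_pos h]
    linarith [le_abs_self (y - A)]

/-- `A ↦ ∫ |F - A|` is convex with subgradient `-∫ sign (F - A)`, whose sign changes at the supremum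
`M`. Membership of `M` in the set is avoided by using a nearby `B` between `M` and `A` and the
Lipschitz bound in `A`. -/
lemma integral_abs_sub_median_le {F : ℝ → ℝ} {μ : Measure ℝ} [IsFiniteMeasure μ] [NeZero μ]
    (hF : Measurable F) {K : ℝ} (hK : ∀ x, |F x| ≤ K) (A : ℝ) :
    ∫ x, |F x - sSup {A : ℝ | 0 ≤ ∫ x, Real.sign (F x - A) ∂μ}| ∂μ ≤ ∫ x, |F x - A| ∂μ := by
  set S : Set ℝ := {A : ℝ | 0 ≤ ∫ x, Real.sign (F x - A) ∂μ}
  have hs1 : ∀ r, |Real.sign r| ≤ 1 := fun r => by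
    rcases Real.sign_apply_eq r with h | h | h <;> rw [h] <;> norm_num
  have iF : ∀ B, Integrable (fun x => F x - B) μ := fun B =>
    (Integrable.of_bound hF.aestronglyMeasurable K (ae_of_all _ hK)).sub (integrable_const _)
  have is : ∀ B, Integrable (fun x => Real.sign (F x - B)) μ := fun B =>
    Integrable.of_bound (measurable_real_sign.comp (hF.sub_const B)).aestronglyMeasurable 1
      (ae_of_all _ fun x => hs1 _)
  have hne : S.Nonempty := by
    refine ⟨-K - 1, ?_⟩
    change 0 ≤ ∫ x, Real.sign (F x - (-K - 1)) ∂μ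
    refine integral_nonneg fun x => ?_
    rw [Pi.zero_apply, Real.sign_of_pos (by linarith [neg_abs_le (F x), hK x])]
    norm_num
  have hbd : BddAbove S := ⟨K, fun B hB => by
    by_contra! hlt
    have h1 : ∀ x, Real.sign (F x - B) = -1 := fun x =>
      Real.sign_of_neg (by linarith [le_abs_self (F x), hK x])
    have h2 : 0 ≤ ∫ x, Real.sign (F x - B) ∂μ := hB
    simp only [h1, integral_const, smul_eq_mul] at h2
    have h3 : 0 < μ.real univ := measureReal_univ_pos
    linarith⟩
  set M := sSup S
  set c := μ.real univ
  have hc : 0 ≤ c := measureReal_nonneg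
  have hsub : ∀ A B, ∫ x, |F x - B| ∂μ + (B - A) * ∫ x, Real.sign (F x - B) ∂μ ≤
      ∫ x, |F x - A| ∂μ := fun A B => by
    rw [← integral_const_mul, ← integral_add (iF B).abs ((is B).const_mul _)]
    exact integral_mono ((iF B).abs.add ((is B).const_mul _)) (iF A).abs
      fun x => abs_sub_ge_sign _ _ _
  have hlip : ∀ B, ∫ x, |F x - M| ∂μ ≤ ∫ x, |F x - B| ∂μ + |B - M| * c := fun B => by
    have : ∫ x, (|F x - B| + |B - M|) ∂μ = ∫ x, |F x - B| ∂μ + |B - M| * c := by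
      rw [integral_add (iF B).abs (integrable_const _), integral_const, smul_eq_mul, mul_comm]
    rw [← this]
    refine integral_mono (iF M).abs ((iF B).abs.add (integrable_const _)) fun x => ?_
    calc |F x - M| = |(F x - B) + (B - M)| := by ring_nf
      _ ≤ _ := abs_add_le _ _
  refine le_of_forall_pos_le_add fun ε hε => ?_
  have key : ∀ B, |B - M| * (c + 1) ≤ ε → 0 ≤ (B - A) * ∫ x, Real.sign (F x - B) ∂μ →
      ∫ x, |F x - M| ∂μ ≤ ∫ x, |F x - A| ∂μ + ε := fun B hB h => by
    have h1 := hsub A B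
    have h2 := hlip B
    nlinarith [abs_nonneg (B - M)]
  have hδ : 0 < ε / (c + 1) := by positivity
  rcases lt_trichotomy A M with h | h | h
  · obtain ⟨B, hB⟩ := exists_between (max_lt h (by linarith : M - ε / (c + 1) < M))
    have hB1 : A < B := (le_max_left _ _).trans_lt hB.1
    have hB2 : M - ε / (c + 1) < B := (le_max_right _ _).trans_lt hB.1
    refine key B ?_ (mul_nonneg (by linarith) ?_)
    · rw [← le_div_iff₀ (by positivity), abs_le]; constructor <;> linarith [hB.2]
    -- The sign integral is nonincreasing in the level, so it is nonnegative at `B`, which lies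
    -- below some member `A'` of `S`.
    · obtain ⟨A', hA', hBA⟩ := exists_lt_of_lt_csSup hne hB.2
      refine le_trans hA' (integral_mono (is A') (is B) fun x => ?_)
      simp only
      have hyz : F x - A' < F x - B := by linarith
      rcases lt_trichotomy (F x - B) 0 with h' | h' | h'
      · rw [Real.sign_of_neg h', Real.sign_of_neg (hyz.trans h')]
      · rw [h', Real.sign_zero, Real.sign_of_neg (by linarith)]; norm_num
      · rw [Real.sign_of_pos h']
        exact (abs_le.1 (hs1 _)).2
  · rw [h]; linarith
  · obtain ⟨B, hB⟩ := exists_between (lt_min h (by linarith : M < M + ε / (c + 1)))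
    have hB1 : B < A := hB.2.trans_le (min_le_left _ _)
    have hB2 : B < M + ε / (c + 1) := hB.2.trans_le (min_le_right _ _)
    refine key B ?_ (mul_nonneg_of_nonpos_of_nonpos (by linarith) ?_)
    · rw [← le_div_iff₀ (by positivity), abs_le]; constructor <;> linarith [hB.1]
    · by_contra! h0
      exact absurd (le_csSup hbd (show B ∈ S from h0.le)) (not_le.2 hB.1)

/-! ### Comparison with the optimal value -/

/-- The centred primitive `F - A*`. -/
noncomputable def starFlux (D : Dom) (V f : ℝ → ℝ) (x : ℝ) : ℝ := primF D V f x - Astar D V f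

instance : IsFiniteMeasure Dom.torus.vol := by
  simp only [Dom.vol]
  infer_instance

namespace Admissible

variable {D : Dom} {V f U : ℝ → ℝ}

lemma continuous_starFlux (h : Admissible D V f U) : Continuous (starFlux D V f) :=
  h.contDiff_primF.continuous.sub continuous_const

lemma integrable_starFlux_sq (h : Admissible D V f U) :
    Integrable (fun x => starFlux D V f x ^ 2 * Real.exp ((V + U) x)) D.vol := by
  cases D
  · exact h.integrable_flux_sq
  · have := h.continuous_starFlux
    have hW := h.contW
    exact Dom.integrable_torus (Continuous.locallyIntegrable (by fun_prop))

/-- Pointwise, `|G| ≤ G² e^{V+U} + e^{-(V+U)}` by the arithmetic–geometric mean inequality. -/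
lemma integrable_starFlux (h : Admissible D V f U) : Integrable (starFlux D V f) D.vol := by
  refine (h.integrable_starFlux_sq.add h.intW).mono' h.continuous_starFlux.aestronglyMeasurable
    (ae_of_all _ fun x => ?_)
  set w := (V + U) x
  have e1 : Real.exp w = Real.exp (w / 2) ^ 2 := by
    rw [← Real.exp_nat_mul]; congr 1; push_cast; ring
  have e2 : Real.exp (w / 2) * Real.exp (-(w / 2)) = 1 := by rw [← Real.exp_add]; simp
  have e3 : Real.exp (-w) = Real.exp (-(w / 2)) ^ 2 := by
    rw [← Real.exp_nat_mul]; congr 1; push_cast; ring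
  change |starFlux D V f x| ≤ starFlux D V f x ^ 2 * Real.exp w + Real.exp (-w)
  rw [e1, e3, ← sq_abs]
  set a := |starFlux D V f x|
  have ha : 0 ≤ a := abs_nonneg _
  nlinarith [sq_nonneg (a * Real.exp (w / 2) - Real.exp (-(w / 2))), mul_nonneg ha ha]

lemma integrable_flux (h : Admissible D V f U) : Integrable (flux D V f U) D.vol := by
  cases D
  · exact h.integrable_starFlux
  · exact Dom.integrable_torus h.continuous_flux.locallyIntegrable

lemma integral_abs_starFlux_le (h : Admissible D V f U) :
    ∫ x, |starFlux D V f x| ∂D.vol ≤ ∫ x, |flux D V f U x| ∂D.vol := by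
  cases D
  · exact le_rfl
  · have hs : Dom.torus.SmoothCompact (primF .torus V f) := ⟨h.contDiff_primF, h.per_primF⟩
    obtain ⟨K, hK⟩ := hs.bounded
    exact integral_abs_sub_median_le hs.continuous.measurable hK _

/-- On the torus the weighted mean `A_U` minimises the weighted quadratic integral of `F - A` over
constants `A`; on the line the two fluxes coincide. -/
lemma integral_flux_sq_le (h : Admissible D V f U) :
    ∫ x, flux D V f U x ^ 2 * Real.exp ((V + U) x) ∂D.vol ≤
      ∫ x, starFlux D V f x ^ 2 * Real.exp ((V + U) x) ∂D.vol := by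
  cases D
  · exact le_rfl
  set c := fluxConst .torus V f U - Astar .torus V f
  have hW := h.contW
  have hG := h.continuous_flux
  have i1 : Integrable (fun x => flux .torus V f U x * Real.exp ((V + U) x)) Dom.torus.vol :=
    Dom.integrable_torus (Continuous.locallyIntegrable (by fun_prop))
  have i2 : Integrable (fun x => Real.exp ((V + U) x)) Dom.torus.vol :=
    Dom.integrable_torus (Continuous.locallyIntegrable (by fun_prop))
  have i3 : Integrable (fun x => flux .torus V f U x ^ 2 * Real.exp ((V + U) x) +
      2 * c * (flux .torus V f U x * Real.exp ((V + U) x))) Dom.torus.vol :=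
    h.integrable_flux_sq.add (i1.const_mul _)
  have e : (fun x => starFlux .torus V f x ^ 2 * Real.exp ((V + U) x)) = fun x =>
      flux .torus V f U x ^ 2 * Real.exp ((V + U) x) +
      2 * c * (flux .torus V f U x * Real.exp ((V + U) x)) + c ^ 2 * Real.exp ((V + U) x) := by
    funext x
    simp only [starFlux, flux, c]
    ring
  rw [e, integral_add i3 (i2.const_mul _), integral_add h.integrable_flux_sq (i1.const_mul _),
    integral_const_mul, integral_const_mul, h.integral_flux_exp rfl]
  have : 0 ≤ ∫ x, Real.exp ((V + U) x) ∂Dom.torus.vol := integral_nonneg fun x => (Real.exp_pos _).le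
  nlinarith [mul_nonneg (sq_nonneg c) this]

/-- Cauchy–Schwarz with weights `e^{V+U}` and `e^{-(V+U)}`, followed by minimality of `A*` for the
`L¹` distance. -/
lemma sigmaStar_le_asymVar (h : Admissible D V f U) : sigmaStar D V f ≤ asymVar D V f U := by
  rw [h.asymVar_eq, sigmaStar]
  refine mul_le_mul_of_nonneg_left ?_ (by positivity)
  have h1 : (∫ x, |flux D V f U x| * 1 ∂D.vol) ^ 2 ≤
      (∫ x, |flux D V f U x| ^ 2 * Real.exp ((V + U) x) ∂D.vol) *
        ∫ x, (1 : ℝ) ^ 2 * Real.exp (-(V + U) x) ∂D.vol :=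
    sq_integral_mul_le_weighted (by simpa only [sq_abs] using h.integrable_flux_sq)
      (by simpa using h.intW) (by simpa only [mul_one] using h.integrable_flux.abs)
  simp only [sq_abs, mul_one, one_pow, one_mul] at h1
  rw [mul_comm]
  refine le_trans ?_ h1
  have h2 : 0 ≤ ∫ x, |starFlux D V f x| ∂D.vol := integral_nonneg fun x => abs_nonneg _
  exact pow_le_pow_left₀ h2 h.integral_abs_starFlux_le 2

/-! ### Near-optimal biasing potentials -/

/-- Smooth compactly supported biasing potentials approximating the optimal one. -/
lemma exists_biasing_le (h : Admissible D V f 0) {ε : ℝ} (hε : 0 < ε) :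
    ∃ U, D.SmoothCompact U ∧
      partition D (V + U) * ∫ x, starFlux D V f x ^ 2 * Real.exp ((V + U) x) ∂D.vol ≤
        (∫ x, |starFlux D V f x| ∂D.vol) ^ 2 + ε := by
  obtain ⟨χ, hχ, hχ0, hχ1, hχn⟩ := D.exists_cutoff
  obtain ⟨hV, hVp⟩ := Dom.smooth_iff.1 h.smoothV
  set G := starFlux D V f
  have hG : ContDiff ℝ ∞ G := h.contDiff_primF.sub contDiff_const
  have hGp : D.Per G := h.per_primF.comp fun a => a - Astar D V f
  have hGi : Integrable (fun x => |G x|) D.vol := h.integrable_starFlux.abs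
  have hG2 : Integrable (fun x => G x ^ 2 * Real.exp (V x)) D.vol := by
    simpa using h.integrable_starFlux_sq
  have hχi : ∀ n, Integrable (χ n) D.vol := fun n => by
    simpa using Dom.integrable_mul_test (D := D) (u := fun _ => 1)
      (continuous_const.locallyIntegrable) (hχ n)
  set S : ℕ → ℝ := fun n => ∫ x, χ n x ∂D.vol
  have hS : ∀ n, 0 ≤ S n := fun n => integral_nonneg (hχ0 n)
  -- The regularisation adds at most `δ n * χ n` to the mass. Dividing by `S n + 1` makes this
  -- negligible although the cutoffs may have growing mass.
  set δ : ℕ → ℝ := fun n => 1 / ((n + 1) * (S n + 1))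
  have hδ : ∀ n, 0 < δ n := fun n => by have := hS n; positivity
  have hδS : ∀ n, δ n * S n ≤ 1 / ((n : ℝ) + 1) := fun n => by
    have := hS n
    rw [show δ n * S n = 1 / ((n : ℝ) + 1) * (S n / (S n + 1)) by simp only [δ]; field_simp]
    refine mul_le_of_le_one_right (by positivity) ?_
    rw [div_le_one (by positivity)]
    linarith
  set s : ℕ → ℝ → ℝ := fun n x => √(G x ^ 2 + δ n ^ 2)
  have hs0 : ∀ n x, 0 < s n x := fun n x =>
    Real.sqrt_pos.2 (add_pos_of_nonneg_of_pos (sq_nonneg _) (pow_pos (hδ n) 2))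
  have hsG : ∀ n x, |G x| ≤ s n x := fun n x =>
    Real.abs_le_sqrt (by linarith [sq_nonneg (δ n)])
  have hsδ : ∀ n x, s n x ≤ |G x| + δ n := fun n x => by
    refine Real.sqrt_le_iff.2 ⟨add_nonneg (abs_nonneg _) (hδ n).le, ?_⟩
    nlinarith [mul_nonneg (abs_nonneg (G x)) (hδ n).le, sq_abs (G x)]
  -- This is the density `e^{-(V + U n)}`: close to `|G|` where `χ n = 1`, and equal to `e^{-V}`
  -- where `χ n = 0`, so that `U n` vanishes there.
  set w : ℕ → ℝ → ℝ := fun n x => χ n x * s n x + (1 - χ n x) * Real.exp (-V x)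
  have hw0 : ∀ n x, 0 < w n x := fun n x => by
    have h1 := hs0 n x
    have h2 := Real.exp_pos (-V x)
    rcases (hχ0 n x).eq_or_lt with h3 | h3
    · simp only [w, ← h3]
      linarith
    · exact add_pos_of_pos_of_nonneg (mul_pos h3 h1)
        (mul_nonneg (by linarith [hχ1 n x]) h2.le)
  set U : ℕ → ℝ → ℝ := fun n x => -Real.log (w n x) - V x
  have hUexp : ∀ n x, Real.exp (-(V + U n) x) = w n x := fun n x => by
    rw [show -(V + U n) x = Real.log (w n x) by simp [U], Real.exp_log (hw0 n x)]
  have hUexp' : ∀ n x, Real.exp ((V + U n) x) = (w n x)⁻¹ := fun n x => by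
    rw [← hUexp, ← Real.exp_neg, neg_neg]
  have hU : ∀ n, D.SmoothCompact (U n) := fun n => by
    have hsc : ContDiff ℝ ∞ (s n) := ((hG.pow 2).add contDiff_const).sqrt fun x =>
      (add_pos_of_nonneg_of_pos (sq_nonneg _) (pow_pos (hδ n) 2)).ne'
    have hwc : ContDiff ℝ ∞ (w n) :=
      ((hχ n).contDiff.mul hsc).add ((contDiff_const.sub (hχ n).contDiff).mul hV.neg.exp)
    have hUc : ContDiff ℝ ∞ (U n) := (hwc.log fun x => (hw0 n x).ne').neg.sub hV
    have hUp : D.Per (U n) := by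
      have h1 : D.Per (s n) := hGp.comp fun a => √(a ^ 2 + δ n ^ 2)
      have h2 : D.Per fun x => χ n x * s n x := (Dom.smooth_iff.1 (hχ n).smooth).2.comp₂ (· * ·) h1
      have h3 : D.Per fun x => (1 - χ n x) * Real.exp (-V x) :=
        (Dom.smooth_iff.1 (hχ n).smooth).2.comp₂ (fun a b => (1 - a) * Real.exp (-b)) hVp
      exact (h2.comp₂ (· + ·) h3).comp₂ (fun a b => -Real.log a - b) hVp
    cases D
    · refine ⟨hUc, (hχ n).2.mono fun x hx => ?_⟩
      contrapose! hx
      rw [Function.notMem_support] at hx ⊢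
      simp [U, w, hx]
    · exact ⟨hUc, hUp⟩
  -- the two tails
  have htail : ∀ {k : ℝ → ℝ}, Integrable k D.vol →
      (∀ n, Integrable (fun x => (1 - χ n x) * k x) D.vol) ∧
      Tendsto (fun n => ∫ x, (1 - χ n x) * k x ∂D.vol) atTop (𝓝 0) := fun {k} hk => by
    have hb : ∀ n x, ‖(1 - χ n x) * k x‖ ≤ ‖k x‖ := fun n x => by
      rw [norm_mul, Real.norm_eq_abs, abs_of_nonneg (by linarith [hχ1 n x])]
      exact mul_le_of_le_one_left (norm_nonneg _) (by linarith [hχ0 n x])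
    have hm : ∀ n, AEStronglyMeasurable (fun x => (1 - χ n x) * k x) D.vol := fun n =>
      ((continuous_const.sub (hχ n).continuous).aestronglyMeasurable).mul hk.1
    refine ⟨fun n => hk.norm.mono' (hm n) (ae_of_all _ (hb n)), ?_⟩
    have := tendsto_integral_of_dominated_convergence (f := fun _ => (0 : ℝ)) (fun x => ‖k x‖)
      hm hk.norm (fun n => ae_of_all _ (hb n)) (ae_of_all _ fun x => by
        obtain ⟨N, hN⟩ := exists_nat_ge |x|
        refine tendsto_const_nhds.congr' ?_
        filter_upwards [eventually_ge_atTop N] with n hn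
        rw [hχn n x (hN.trans (by exact_mod_cast hn)), sub_self, zero_mul])
    simpa using this
  obtain ⟨i1, t1⟩ := htail h.intV
  obtain ⟨i2, t2⟩ := htail hG2
  set a := ∫ x, |G x| ∂D.vol
  have hZ : ∀ n, partition D (V + U n) ≤
      a + 1 / ((n : ℝ) + 1) + ∫ x, (1 - χ n x) * Real.exp (-V x) ∂D.vol := fun n => by
    have j : Integrable (fun x => |G x| + δ n * χ n x) D.vol := hGi.add ((hχi n).const_mul _)
    calc partition D (V + U n)
        ≤ ∫ x, (|G x| + δ n * χ n x + (1 - χ n x) * Real.exp (-V x)) ∂D.vol := by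
          simp only [partition, hUexp]
          refine integral_mono_of_nonneg (ae_of_all _ fun x => (hw0 n x).le) (j.add (i1 n))
            (ae_of_all _ fun x => ?_)
          simp only [w]
          have := mul_le_mul_of_nonneg_left (hsδ n x) (hχ0 n x)
          nlinarith [mul_nonneg (sub_nonneg.2 (hχ1 n x)) (abs_nonneg (G x))]
      _ = a + δ n * S n + ∫ x, (1 - χ n x) * Real.exp (-V x) ∂D.vol := by
          rw [integral_add j (i1 n), integral_add hGi ((hχi n).const_mul _), integral_const_mul]
      _ ≤ _ := by gcongr; exact hδS n
  have hI : ∀ n, ∫ x, G x ^ 2 * Real.exp ((V + U n) x) ∂D.vol ≤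
      a + ∫ x, (1 - χ n x) * (G x ^ 2 * Real.exp (V x)) ∂D.vol := fun n => by
    rw [← integral_add hGi (i2 n)]
    refine integral_mono_of_nonneg (ae_of_all _ fun x => by positivity) (hGi.add (i2 n))
      (ae_of_all _ fun x => ?_)
    simp only [hUexp']
    have hχ0x := hχ0 n x
    have hχ1x := sub_nonneg.2 (hχ1 n x)
    have hsx := hs0 n x
    have hex := Real.exp_pos (-V x)
    -- Convexity of the inverse: it separates the optimal part from a tail of the integrable
    -- function `G² e^V`.
    have hinv : (w n x)⁻¹ ≤ χ n x * (s n x)⁻¹ + (1 - χ n x) * (Real.exp (-V x))⁻¹ := by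
      rw [inv_le_iff_one_le_mul₀ (hw0 n x)]
      have hpq : 2 * (s n x * Real.exp (-V x)) ≤ s n x ^ 2 + Real.exp (-V x) ^ 2 := by
        nlinarith [sq_nonneg (s n x - Real.exp (-V x))]
      have e : (χ n x * (s n x)⁻¹ + (1 - χ n x) * (Real.exp (-V x))⁻¹) * w n x =
          χ n x ^ 2 + (1 - χ n x) ^ 2 + χ n x * (1 - χ n x) *
            ((s n x ^ 2 + Real.exp (-V x) ^ 2) / (s n x * Real.exp (-V x))) := by
        simp only [w]
        field_simp
        ring
      rw [← le_div_iff₀ (by positivity)] at hpq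
      rw [e]
      nlinarith [mul_le_mul_of_nonneg_left hpq (mul_nonneg hχ0x hχ1x)]
    have hGs : G x ^ 2 * (s n x)⁻¹ ≤ |G x| := by
      rw [← div_eq_mul_inv, div_le_iff₀ hsx, ← sq_abs, sq]
      exact mul_le_mul_of_nonneg_left (hsG n x) (abs_nonneg _)
    rw [← Real.exp_neg, neg_neg] at hinv
    calc G x ^ 2 * (w n x)⁻¹
        ≤ G x ^ 2 * (χ n x * (s n x)⁻¹ + (1 - χ n x) * Real.exp (V x)) := by gcongr
      _ = χ n x * (G x ^ 2 * (s n x)⁻¹) + (1 - χ n x) * (G x ^ 2 * Real.exp (V x)) := by ring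
      _ ≤ 1 * |G x| + (1 - χ n x) * (G x ^ 2 * Real.exp (V x)) := by
          gcongr
          exact hχ1 n x
      _ = _ := by rw [one_mul]
  have hlim : Tendsto (fun n : ℕ =>
      (a + 1 / ((n : ℝ) + 1) + ∫ x, (1 - χ n x) * Real.exp (-V x) ∂D.vol) *
      (a + ∫ x, (1 - χ n x) * (G x ^ 2 * Real.exp (V x)) ∂D.vol)) atTop (𝓝 (a ^ 2)) := by
    have := ((tendsto_one_div_add_atTop_nhds_zero_nat (𝕜 := ℝ)).const_add a |>.add t1).mul
      (t2.const_add a)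
    simpa [sq] using this
  obtain ⟨n, hn⟩ := (hlim.eventually (gt_mem_nhds (lt_add_of_pos_right _ hε))).exists
  refine ⟨U n, hU n, le_trans (mul_le_mul (hZ n) (hI n) (integral_nonneg fun x => by positivity) ?_)
    hn.le⟩
  have h1 : 0 ≤ ∫ x, (1 - χ n x) * Real.exp (-V x) ∂D.vol := integral_nonneg fun x =>
    mul_nonneg (sub_nonneg.2 (hχ1 n x)) (Real.exp_pos _).le
  have h2 : 0 ≤ a := integral_nonneg fun x => abs_nonneg _
  positivity

/-- The lower bound holds on all nice potentials and test functions already approach it. Every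
intermediate class thus has the same infimum, which gives both infima of the theorem. -/
lemma isGLB_asymVar (h : Admissible D V f 0) {s : Set (ℝ → ℝ)} (hs : ∀ U ∈ s, MemU0 D V f U)
    (hc : ∀ U, D.SmoothCompact U → U ∈ s) :
    IsGLB (asymVar D V f '' s) (sigmaStar D V f) := by
  have hadm : ∀ U ∈ s, Admissible D V f U := fun U hU =>
    ⟨h.smoothV, h.smoothf, h.intV, h.intf, hs U hU⟩
  refine ⟨?_, fun b hb => le_of_forall_pos_le_add fun ε hε => ?_⟩
  · rintro _ ⟨U, hU, rfl⟩
    exact (hadm U hU).sigmaStar_le_asymVar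
  · have hZ := partition_pos h.intV
    -- The tolerance compensates the prefactor `2 / Z²`.
    obtain ⟨U, hU, hle⟩ := h.exists_biasing_le (ε := ε * (partition D V ^ 2 / 2)) (by positivity)
    have hA := hadm U (hc U hU)
    have hZU := partition_pos hA.intW
    calc b ≤ asymVar D V f U := hb ⟨U, hc U hU, rfl⟩
      _ = 2 / partition D V ^ 2 * (partition D (V + U) *
            ∫ x, flux D V f U x ^ 2 * Real.exp ((V + U) x) ∂D.vol) := hA.asymVar_eq
      _ ≤ 2 / partition D V ^ 2 * ((∫ x, |starFlux D V f x| ∂D.vol) ^ 2 +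
            ε * (partition D V ^ 2 / 2)) := by
          gcongr
          exact (mul_le_mul_of_nonneg_left hA.integral_flux_sq_le hZU.le).trans hle
      _ = sigmaStar D V f + ε := by
          rw [sigmaStar, mul_add]
          congr 1
          field_simp

end Admissible

end BiasedLangevin

/-! ### The main theorem -/

theorem mainTheorem1 (D : BiasedLangevin.Dom) (V f : ℝ → ℝ)
    (hV : D.Smooth V)
    (hVint : Integrable (fun x => Real.exp (-V x)) D.vol)
    (hf : D.Smooth f)
    (hfint : Integrable f (BiasedLangevin.gibbs D V))
    (hfconst : ¬ ∃ c : ℝ, ∀ᵐ x ∂(BiasedLangevin.gibbs D V), f x = c)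
    (h0 : BiasedLangevin.MemU0 D V f 0) :
    -- smooth compactly supported biasing potentials are nice
    (∀ U : ℝ → ℝ, D.SmoothCompact U → BiasedLangevin.MemU0 D V f U) ∧
    -- the asymptotic variance of a nice potential is well defined
    (∀ U : ℝ → ℝ, BiasedLangevin.MemU0 D V f U →
      ∃ φ φ' : ℝ → ℝ, BiasedLangevin.IsPoissonSolution D V f U φ φ' ∧
        ∀ ψ ψ' : ℝ → ℝ, BiasedLangevin.IsPoissonSolution D V f U ψ ψ' →
          ψ =ᵐ[D.vol] φ ∧ ψ' =ᵐ[D.vol] φ') ∧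
    -- the optimal value is well defined
    Integrable (fun x => BiasedLangevin.primF D V f x - BiasedLangevin.Astar D V f) D.vol ∧
    -- it is the infimum over nice potentials
    IsGLB (BiasedLangevin.asymVar D V f '' {U | BiasedLangevin.MemU0 D V f U})
      (BiasedLangevin.sigmaStar D V f) ∧
    -- it is also the infimum over smooth compactly supported potentials
    IsGLB (BiasedLangevin.asymVar D V f '' {U | D.SmoothCompact U})
      (BiasedLangevin.sigmaStar D V f) := by
  have h : BiasedLangevin.Admissible D V f 0 := ⟨hV, hf, hVint, hfint, h0⟩
  have hc : ∀ U, D.SmoothCompact U → BiasedLangevin.MemU0 D V f U := fun U hU =>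
    BiasedLangevin.memU0_of_smoothCompact hV h0 hU
  refine ⟨hc, fun U hU => ?_, h.integrable_starFlux, h.isGLB_asymVar (fun U hU => hU) hc,
    h.isGLB_asymVar hc fun U hU => hU⟩
  have hA : BiasedLangevin.Admissible D V f U := ⟨hV, hf, hVint, hfint, hU⟩
  obtain ⟨φ, hφ⟩ := hA.exists_isPoissonSolution
  exact ⟨φ, _, hφ, fun ψ ψ' hψ => ⟨hA.poisson_unique hφ hψ, hA.poisson_deriv_unique hφ hψ⟩⟩
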